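/- Let $k$ be a field of characteristic $2$, let $m \ge 1$, $n = 2m+1$, and let $E$ be a $k$-vector space of dimension $n$ with a fixed volume form. A pair $(q_0,q_1)$ of quadratic forms on $E$ is called regular if $X = V(q_0,q_1)$ is smooth of codimension $2$ in the projective space $|E|\cong\mathbb{P}^{2m}$ of lines in $E$; that is, if at every point $[v]$ of $X$ over an algebraic closure $\bar k$ of $k$ the linear forms $b_0(v,\cdot)$ and $b_1(v,\cdot)$ are linearly independent, where $b_i$ is the polar form of $q_i$. A regular pair has a normal form with invariants $r_0,\dots,r_{n-2}\in k$ if there is a basis $x_0,\dots,x_m,y_0,\dots,y_{m-1}$ of the dual space $E^\vee$ in which $$q_0=\sum_{i=0}^{m}a_{2i}x_i^2+\sum_{i=0}^{m-1}x_{i+1}y_i+\sum_{i=0}^{m-1}r_{2i+1}y_i^2,\qquad q_1=\sum_{i=0}^{m}a_{2i+1}x_i^2+\sum_{i=0}^{m-1}x_iy_i+\sum_{i=0}^{m-1}r_{2i}y_i^2,$$ where $a_0,\dots,a_n$ are the coefficients of the half-discriminant polynomial $\Delta(t_0,t_1)=\tfrac12\operatorname{disc}(t_0q_0+t_1q_1)=\sum_{i=0}^{n}a_it_0^{n-i}t_1^i$.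 Here, for a quadratic form $q=\sum_{1\le i\le j\le n}a_{ij}z_iz_j$ written in coordinates $z_1,\dots,z_n$ with respect to a basis of $E$ on which the volume form takes the value $1$, $\tfrac12\operatorname{disc}(q)=\sum_{i\le j}a_{ij}\operatorname{Pf}_i\operatorname{Pf}_j$, where $\operatorname{Pf}_i$ is the Pfaffian of the matrix of the polar form of $q$ with the $i$-th row and column deleted. The pencil spanned by $q_0,q_1$ has a normal form with invariants $r_0,\dots,r_{n-2}$ if some pair $(p_0,p_1)$ that spans it has one. A generator of $X$ is a linear subspace of $X_{\bar k}$ of the maximal possible dimension, and $X$ is quasi-split if it has a generator defined over $k$. Let $(q_0,q_1)$ be a regular pair. 1. If $k$ is algebraically closed, then $(q_0,q_1)$ has a normal form with $r_0=\dots=r_{n-2}=0$. 2. More generally, over every field $k$ of characteristic $2$, the following are equivalent: (a) $X$ is quasi-split; (b) the pair $(q_0,q_1)$ has a normal form with $r_0=\dots=r_{n-2}=0$; (c) the pencil spanned by $q_0$ and $q_1$ has a normal form with $r_0=\dots=r_{n-2}=0$. -/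

import Mathlib

open scoped TensorProduct

namespace QuadricPencil

/-! Extension of scalars of quadratic forms, in every characteristic -/

section BaseChange

variable {k : Type*} {E : Type*} [Field k] [AddCommGroup E] [Module k E] [FiniteDimensional k E]

/-- The extension of scalars `q_K` of a quadratic form `q` on `E` to `K ⊗ E`. It is obtained by
extending a (not necessarily symmetric) bilinear form `B` with `q v = B v v`; the two lemmas below
show that it extends `q` and its polar form, so it does not depend on `B`.
(Mathlib's own base change needs `2` to be invertible.) -/
noncomputable def extendScalars (K : Type*) [Field K] [Algebra k K] (q : QuadraticForm k E) :
    QuadraticForm K (K ⊗[k] E) :=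
  (LinearMap.BilinForm.baseChange K
    (q.toBilin (Module.finBasis k E) : LinearMap.BilinForm k E)).toQuadraticMap

theorem extendScalars_tmul (K : Type*) [Field K] [Algebra k K] (q : QuadraticForm k E)
    (c : K) (v : E) :
    extendScalars K q (c ⊗ₜ[k] v) = c ^ 2 * algebraMap k K (q v) := by
  have h := congrArg (fun f => f v) (q.toQuadraticMap_toBilin (Module.finBasis k E))
  simp only [LinearMap.BilinMap.toQuadraticMap_apply] at h
  simp only [extendScalars, LinearMap.BilinMap.toQuadraticMap_apply,
    LinearMap.BilinForm.baseChange_tmul, h, Algebra.smul_def]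
  ring

theorem polar_extendScalars_tmul (K : Type*) [Field K] [Algebra k K] (q : QuadraticForm k E)
    (c d : K) (v w : E) :
    QuadraticMap.polar (extendScalars K q) (c ⊗ₜ[k] v) (d ⊗ₜ[k] w)
      = c * d * algebraMap k K (QuadraticMap.polar q v w) := by
  have h : QuadraticMap.polar q v w
      = q.toBilin (Module.finBasis k E) v w + q.toBilin (Module.finBasis k E) w v := by
    conv_lhs => rw [← q.toQuadraticMap_toBilin (Module.finBasis k E)]
    exact LinearMap.BilinMap.polar_toQuadraticMap _ _
  rw [h, extendScalars, LinearMap.BilinMap.polar_toQuadraticMap]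
  simp only [LinearMap.BilinForm.baseChange_tmul, Algebra.smul_def, map_add]
  ring

end BaseChange

/-! Regular pairs, generators, quasi-split intersections -/

section Geometry

variable {k : Type*} {E : Type*} [Field k] [AddCommGroup E] [Module k E] [FiniteDimensional k E]

/-- The pair `(q₀, q₁)` is regular: the scheme `X = V(q₀, q₁)` in the projective space of lines of
`E` is smooth of codimension `2`. That is, at every geometric point `[v]` of `X` the Jacobian of
the two equations has rank `2`; the differential of `q` at `v` is `w ↦ b(v, w)`, where `b` is the
polar form of `q`. -/
def IsRegularPair (q₀ q₁ : QuadraticForm k E) : Prop :=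
  ∀ v : AlgebraicClosure k ⊗[k] E, v ≠ 0 →
    extendScalars (AlgebraicClosure k) q₀ v = 0 → extendScalars (AlgebraicClosure k) q₁ v = 0 →
    LinearIndependent (AlgebraicClosure k)
      ![(extendScalars (AlgebraicClosure k) q₀).polarBilin v,
        (extendScalars (AlgebraicClosure k) q₁).polarBilin v]

/-- The projective linear space of lines in `M` lies on `X = V(q₀, q₁)`, over the algebraic
closure. -/
def LiesOn (q₀ q₁ : QuadraticForm k E)
    (M : Submodule (AlgebraicClosure k) (AlgebraicClosure k ⊗[k] E)) : Prop :=
  ∀ v ∈ M, extendScalars (AlgebraicClosure k) q₀ v = 0 ∧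
    extendScalars (AlgebraicClosure k) q₁ v = 0

/-- A generator of `X = V(q₀, q₁)`: a linear subspace of `X`, over the algebraic closure, of the
maximal possible dimension. -/
def IsGenerator (q₀ q₁ : QuadraticForm k E)
    (M : Submodule (AlgebraicClosure k) (AlgebraicClosure k ⊗[k] E)) : Prop :=
  LiesOn q₀ q₁ M ∧ ∀ N : Submodule (AlgebraicClosure k) (AlgebraicClosure k ⊗[k] E),
    LiesOn q₀ q₁ N →
      Module.finrank (AlgebraicClosure k) N ≤ Module.finrank (AlgebraicClosure k) M

/-- `X = V(q₀, q₁)` is quasi-split: it has a generator that is defined over `k`. -/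
def IsQuasiSplit (q₀ q₁ : QuadraticForm k E) : Prop :=
  ∃ L : Submodule k E, IsGenerator q₀ q₁ (L.baseChange (AlgebraicClosure k))

end Geometry

/-! The half-discriminant -/

/-- The Pfaffian of an alternating matrix over a ring of characteristic `2`, as the sum over all
perfect matchings of the index set of the product of the entries at the matched pairs. A perfect
matching is given as an involution without fixed points. The signs of the general formula are
left out, since `-1 = 1` in such a ring. -/
def pfaffianCharTwo {ι R : Type*} [Fintype ι] [LinearOrder ι] [CommRing R]
    (B : Matrix ι ι R) : R :=
  ∑ σ : Equiv.Perm ι with (∀ i, σ (σ i) = i) ∧ ∀ i, σ i ≠ i,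
    ∏ i : ι with i < σ i, B i (σ i)

/-- The `i`-th coordinate `Pf_i` of the canonical vector `ω`: the Pfaffian of the matrix that
remains when the `i`-th row and the `i`-th column are deleted. -/
def omegaCoord {ι R : Type*} [Fintype ι] [LinearOrder ι] [CommRing R]
    (B : Matrix ι ι R) (i : ι) : R :=
  pfaffianCharTwo (B.submatrix (fun j : {j : ι // j ≠ i} => j.1) (fun j : {j : ι // j ≠ i} => j.1))

/-- The half-discriminant `∑_{i ≤ j} a_{ij} Pf_i Pf_j` of `∑_{i ≤ j} a_{ij} x_i x_j`, over a ring of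
characteristic `2`. The matrix `a` is symmetric: `a i j` with `i ≠ j` is the coefficient of
`x_i x_j`, so that the matrix of the polar form is `a` with its diagonal replaced by `0`. -/
def halfDiscForm {ι R : Type*} [Fintype ι] [LinearOrder ι] [CommRing R]
    (a : Matrix ι ι R) : R :=
  ∑ p : ι × ι with p.1 ≤ p.2, a p.1 p.2 *
    (omegaCoord (Matrix.of fun i j => if i = j then 0 else a i j) p.1 *
      omegaCoord (Matrix.of fun i j => if i = j then 0 else a i j) p.2)

/-- The coefficients of a quadratic form in the coordinates of the basis `e`. -/
noncomputable def coeffMatrix {k E ι : Type*} [Field k] [AddCommGroup E] [Module k E] [DecidableEq ι]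
    (e : Module.Basis ι k E) (q : QuadraticForm k E) : Matrix ι ι k :=
  Matrix.of fun i j => if i = j then q (e i) else QuadraticMap.polar q (e i) (e j)

/-- The half-discriminant polynomial `Δ(t₀, t₁) = ½disc(t₀ q₀ + t₁ q₁)`, for the volume form on
`E` that takes the value `1` on the basis `e`. -/
noncomputable def halfDisc {k E ι : Type*} [Field k] [AddCommGroup E] [Module k E]
    [Fintype ι] [LinearOrder ι] (e : Module.Basis ι k E) (q₀ q₁ : QuadraticForm k E) :
    MvPolynomial (Fin 2) k :=
  halfDiscForm (Matrix.of fun i j =>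
    MvPolynomial.X 0 * MvPolynomial.C (coeffMatrix e q₀ i j) +
      MvPolynomial.X 1 * MvPolynomial.C (coeffMatrix e q₁ i j))

/-- The coefficient `a_i` of `t₀^(n-i) t₁^i` in `Δ`, where `n = 2m+1` and `0 ≤ i ≤ n`. -/
noncomputable def halfDiscCoeff {k E : Type*} [Field k] [AddCommGroup E] [Module k E] {m : ℕ}
    (e : Module.Basis (Fin (2 * m + 1)) k E) (q₀ q₁ : QuadraticForm k E)
    (i : Fin (2 * m + 2)) : k :=
  (halfDisc e q₀ q₁).coeff (Finsupp.single 0 (2 * m + 1 - i.1) + Finsupp.single 1 i.1)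

/-! Normal forms -/

/-- The pair `(q₀, q₁)` can be put in normal form with invariants `r₀, …, r_{2m-1}`: there is a
basis `x₀, …, x_m, y₀, …, y_{m-1}` of the dual space of `E` in which
`q₀ = ∑ a_{2i} x_i² + ∑ x_{i+1} y_i + ∑ r_{2i+1} y_i²` and
`q₁ = ∑ a_{2i+1} x_i² + ∑ x_i y_i + ∑ r_{2i} y_i²`,
where `a₀, …, a_{2m+1}` are the coefficients of the half-discriminant polynomial. In other words,
the basis of `E` dual to the `x_i, y_i` is a Kronecker basis. -/
def HasNormalForm {k E : Type*} [Field k] [AddCommGroup E] [Module k E] {m : ℕ}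
    (e : Module.Basis (Fin (2 * m + 1)) k E) (q₀ q₁ : QuadraticForm k E)
    (r : Fin (2 * m) → k) : Prop :=
  ∃ B : Module.Basis (Fin (m + 1) ⊕ Fin m) k (Module.Dual k E),
    (∀ v : E, q₀ v =
      ∑ i : Fin (m + 1), halfDiscCoeff e q₀ q₁ ⟨2 * i.1, by omega⟩ * (B (Sum.inl i) v) ^ 2
      + ∑ i : Fin m, B (Sum.inl i.succ) v * B (Sum.inr i) v
      + ∑ i : Fin m, r ⟨2 * i.1 + 1, by omega⟩ * (B (Sum.inr i) v) ^ 2) ∧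
    (∀ v : E, q₁ v =
      ∑ i : Fin (m + 1), halfDiscCoeff e q₀ q₁ ⟨2 * i.1 + 1, by omega⟩ * (B (Sum.inl i) v) ^ 2
      + ∑ i : Fin m, B (Sum.inl i.castSucc) v * B (Sum.inr i) v
      + ∑ i : Fin m, r ⟨2 * i.1, by omega⟩ * (B (Sum.inr i) v) ^ 2)

end QuadricPencil

/-! The polar forms `b₀`, `b₁` are alternating on a space of odd dimension `2m+1`, so they have a
common isotropic subspace `W` of dimension `m+1` (`exists_isotropic`). For a complement `C` of `W`
they give two maps from `C` to the dual of `W`. If no nonzero subspace `S` of `C` satisfies `b₀(S) ⊆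
b₁(S)`, this pencil of maps is a single Kronecker block (`exists_kronecker_bases`), and a basis
`e_i` of `W`, `f_j` of `C` puts the pairing in the required shape.

If `X` contains a subspace `L` over `k` of dimension `m`, regularity makes `L` a complement of `W`
that satisfies this condition: a bad `S` would yield an eigenvector over the algebraic closure, a
point of `X` with dependent differentials. Taking `C = L` kills all terms in the `y_i`. For such a
basis the adjugate of the polar pencil is a rank one square. This computes `Δ` and identifies
`q₀(e_i)`, `q₁(e_i)` with `a_{2i}`, `a_{2i+1}` up to one square, which a rescaling removes
(`halfDiscCoeff_of_isKroneckerBasis`).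

Over an algebraically closed field `L` is constructed (`exists_singular_subspace`). A Kronecker
basis exists because every member of the polar pencil has a kernel of dimension at most one.
Replacing `f_j` by `f_j + ∑ a_{ij} e_i`, the polar conditions are linear with solutions `c_{ij} +
s_{i+j}`, and the remaining conditions on `s` are Artin–Schreier equations
(`exists_add_semilinear_eq`). Over the closure this shows that generators have vector space
dimension exactly `m`. Conversely, a normal form with zero invariants contains the `m`-dimensional
space where all `x_i` vanish, and lying on `X` depends only on the pencil. -/

namespace QuadricPencil

/-! ### Determinants and Pfaffians of alternating matrices in characteristic 2 -/

section Pfaffian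

variable {ι R : Type*} [Fintype ι] [CommRing R] [CharP R 2]

/-- Without signs, a permutation and its inverse contribute the same term, so they cancel in pairs.
A self-inverse permutation with a fixed point contributes a diagonal entry, which is zero. -/
theorem det_eq_sum_involutions [DecidableEq ι] (M : Matrix ι ι R) (hs : ∀ i j, M i j = M j i)
    (hd : ∀ i, M i i = 0) :
    M.det = ∑ σ : Equiv.Perm ι with (∀ i, σ (σ i) = i) ∧ ∀ i, σ i ≠ i, ∏ i, M i (σ i) := by
  have h1 : M.det = ∑ σ : Equiv.Perm ι, ∏ i, M i (σ i) := by
    rw [Matrix.det_apply]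
    refine Finset.sum_congr rfl fun σ _ => ?_
    have : (Equiv.Perm.sign σ : ℤˣ) • ∏ i, M (σ i) i = ∏ i, M (σ i) i := by
      rcases Int.units_eq_one_or (Equiv.Perm.sign σ) with h | h
      · rw [h, one_smul]
      · rw [h, Units.neg_smul, one_smul, CharTwo.neg_eq]
    rw [this]
    exact Finset.prod_congr rfl fun i _ => hs _ _
  rw [h1, ← Finset.sum_filter_add_sum_filter_not Finset.univ
    (fun σ : Equiv.Perm ι => (∀ i, σ (σ i) = i) ∧ ∀ i, σ i ≠ i)]
  rw [add_eq_left]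
  refine Finset.sum_involution (fun σ _ => σ⁻¹) ?_ ?_ ?_ ?_
  · intro σ _
    have : ∏ i, M i (σ⁻¹ i) = ∏ i, M i (σ i) := by
      rw [← Equiv.prod_comp σ]
      exact Finset.prod_congr rfl fun i _ => by simp [hs]
    rw [this, CharTwo.add_self_eq_zero]
  · intro σ hσ hne heq
    apply hne
    have hinv : ∀ i, σ (σ i) = i := fun i => by
      rw [← DFunLike.congr_fun heq (σ i)]; simp
    simp only [Finset.mem_filter, Finset.mem_univ, true_and, not_and, not_forall, not_not] at hσ
    obtain ⟨i, hi⟩ := hσ hinv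
    exact Finset.prod_eq_zero (Finset.mem_univ i) (by rw [hi, hd])
  · intro σ hσ
    simp only [Finset.mem_filter, Finset.mem_univ, true_and] at hσ ⊢
    intro h
    apply hσ
    constructor
    · intro i
      have := h.1 (σ (σ i))
      simp at this
      exact this.symm
    · intro i hi
      exact h.2 i (by rw [Equiv.Perm.inv_eq_iff_eq]; exact hi.symm)
  · intro σ _
    simp

/-- Squaring is additive, so the square of the sum over matchings is the sum of squares. By symmetry
the factors with `i < σ i` and those with `σ i < i` have equal products. -/
theorem pfaffianCharTwo_sq [LinearOrder ι] (M : Matrix ι ι R) (hs : ∀ i j, M i j = M j i)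
    (hd : ∀ i, M i i = 0) : pfaffianCharTwo M ^ 2 = M.det := by
  rw [det_eq_sum_involutions M hs hd, pfaffianCharTwo, CharTwo.sum_sq]
  refine Finset.sum_congr rfl fun σ hσ => ?_
  simp only [Finset.mem_filter, Finset.mem_univ, true_and] at hσ
  rw [← Finset.prod_filter_mul_prod_filter_not Finset.univ (fun i => i < σ i), sq]
  congr 1
  refine Finset.prod_bij' (fun i _ => σ i) (fun i _ => σ i) ?_ ?_ ?_ ?_ ?_
  · intro i hi
    simp only [Finset.mem_filter, Finset.mem_univ, true_and, hσ.1, not_lt] at hi ⊢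
    exact hi.le
  · intro i hi
    simp only [Finset.mem_filter, Finset.mem_univ, true_and, hσ.1, not_lt] at hi ⊢
    exact lt_of_le_of_ne hi (hσ.2 i)
  · intro i _
    exact hσ.1 i
  · intro i _
    exact hσ.1 i
  · intro i _
    rw [hσ.1, hs]

theorem det_eq_zero_of_odd_card [DecidableEq ι] (M : Matrix ι ι R) (hs : ∀ i j, M i j = M j i)
    (hd : ∀ i, M i i = 0) (ho : Odd (Fintype.card ι)) : M.det = 0 := by
  rw [det_eq_sum_involutions M hs hd, Finset.sum_eq_zero]
  intro σ hσ
  simp only [Finset.mem_filter, Finset.mem_univ, true_and] at hσ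
  exfalso
  have h2 : ¬ 2 ∣ Fintype.card ι := fun h => (Nat.not_even_iff_odd.2 ho) (even_iff_two_dvd.2 h)
  have : Fact (Nat.Prime 2) := ⟨Nat.prime_two⟩
  obtain ⟨i, hi⟩ := Equiv.Perm.exists_fixed_point_of_prime (p := 2) (n := 1) h2
    (σ := σ) (by ext i; simp [sq, hσ.1])
  exact hσ.2 i hi

end Pfaffian

/-! ### Common isotropic subspaces of two alternating forms -/

section Isotropic

variable {k E : Type*} [Field k] [AddCommGroup E] [Module k E]

theorem symm_of_isAlt [CharP k 2] {b : E →ₗ[k] E →ₗ[k] k} (hb : b.IsAlt) (v w : E) : b v w = b w v := by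
  rw [← hb.neg, CharTwo.neg_eq]

theorem exists_radical_of_odd [CharP k 2] [FiniteDimensional k E] {b : E →ₗ[k] E →ₗ[k] k}
    (hb : b.IsAlt) (H : Submodule k E)
    (hH : Odd (Module.finrank k H)) : ∃ v ∈ H, v ≠ 0 ∧ ∀ w ∈ H, b v w = 0 := by
  let u := Module.finBasis k H
  let M : Matrix _ _ k := Matrix.of fun i j => b (u j : E) (u i : E)
  have hdet : M.det = 0 := det_eq_zero_of_odd_card M (fun i j => symm_of_isAlt hb _ _)
    (fun i => hb _) (by simpa using hH)
  obtain ⟨c, hc, hM⟩ := Matrix.exists_mulVec_eq_zero_iff.2 hdet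
  refine ⟨((∑ j, c j • u j : H) : E), Subtype.property _, ?_, ?_⟩
  · intro h
    apply hc
    have h0 : ∑ j, c j • u j = 0 := by exact_mod_cast h
    exact funext (Fintype.linearIndependent_iff.1 u.linearIndependent c h0)
  · intro w hw
    have key : (b ((∑ j, c j • u j : H) : E)) ∘ₗ H.subtype = 0 := by
      refine u.ext fun i => ?_
      have := congrFun hM i
      simp only [Matrix.mulVec, dotProduct, M, Matrix.of_apply, Pi.zero_apply] at this
      simp only [LinearMap.comp_apply, Submodule.subtype_apply, LinearMap.zero_apply,
        Submodule.coe_sum, Submodule.coe_smul, map_sum, LinearMap.sum_apply, map_smul,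
        LinearMap.smul_apply, smul_eq_mul]
      rw [← this]
      exact Finset.sum_congr rfl fun j _ => mul_comm _ _
    exact LinearMap.congr_fun key ⟨w, hw⟩

theorem exists_le_finrank_eq (H : Submodule k E) (d : ℕ) (hd : d ≤ Module.finrank k H) :
    ∃ H' ≤ H, Module.finrank k H' = d := by
  obtain ⟨f, hf⟩ := exists_linearIndependent_of_le_finrank hd
  refine ⟨(Submodule.span k (Set.range f)).map H.subtype, Submodule.map_subtype_le _ _, ?_⟩
  rw [Submodule.finrank_map_subtype_eq, finrank_span_eq_card hf, Fintype.card_fin]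

/-- Induction on `m`: a vector `v` in the radical of `b₀` on `H` is adjoined to an isotropic
subspace found inside a complement of `v` in `H ∩ v^⊥`, where `⊥` refers to `b₁`. -/
theorem exists_isotropic [CharP k 2] [FiniteDimensional k E] {b₀ b₁ : E →ₗ[k] E →ₗ[k] k}
    (h₀ : b₀.IsAlt) (h₁ : b₁.IsAlt) (m : ℕ) :
    ∀ H : Submodule k E, Module.finrank k H = 2 * m + 1 →
    ∃ W ≤ H, Module.finrank k W = m + 1 ∧ ∀ v ∈ W, ∀ w ∈ W, b₀ v w = 0 ∧ b₁ v w = 0 := by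
  induction m with
  | zero =>
    intro H hH
    refine ⟨H, le_rfl, by simpa using hH, ?_⟩
    obtain ⟨u, hu⟩ := finrank_eq_one_iff'.1 (by simpa using hH)
    intro v hv w hw
    obtain ⟨c, hc⟩ := hu.2 ⟨v, hv⟩
    obtain ⟨d, hd⟩ := hu.2 ⟨w, hw⟩
    have hc' : c • (u : E) = v := congrArg Subtype.val hc
    have hd' : d • (u : E) = w := congrArg Subtype.val hd
    rw [← hc', ← hd']
    simp [h₀ (u : E), h₁ (u : E)]
  | succ m ih =>
    intro H hH
    obtain ⟨v, hvH, hv0, hv⟩ := exists_radical_of_odd h₀ H (by rw [hH]; exact ⟨m + 1, rfl⟩)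
    let E₁ : Submodule k E := H ⊓ LinearMap.ker (b₁ v)
    have hE₁ : 2 * m + 2 ≤ Module.finrank k E₁ := by
      have e1 := Submodule.finrank_sup_add_finrank_inf_eq H (LinearMap.ker (b₁ v))
      have e2 := LinearMap.finrank_range_add_finrank_ker (b₁ v)
      have e3 : Module.finrank k (LinearMap.range (b₁ v)) ≤ 1 := by
        simpa using Submodule.finrank_le (LinearMap.range (b₁ v))
      have e4 := Submodule.finrank_le (H ⊔ LinearMap.ker (b₁ v))
      change 2 * m + 2 ≤ Module.finrank k (H ⊓ LinearMap.ker (b₁ v) : Submodule k E)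
      omega
    have hvE₁ : v ∈ E₁ := ⟨hvH, h₁ v⟩
    obtain ⟨C, hC⟩ := Submodule.exists_isCompl (Submodule.span k {(⟨v, hvE₁⟩ : E₁)})
    have hCr := Submodule.finrank_add_eq_of_isCompl hC
    rw [finrank_span_singleton (by simpa using hv0)] at hCr
    have hCm : Module.finrank k (C.map E₁.subtype) = Module.finrank k C :=
      Submodule.finrank_map_subtype_eq _ _
    obtain ⟨H', hH'C, hH'⟩ := exists_le_finrank_eq (C.map E₁.subtype) (2 * m + 1) (by omega)
    obtain ⟨W, hW, hWr, hWi⟩ := ih H' hH'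
    have hWE : W ≤ E₁ := hW.trans (hH'C.trans (Submodule.map_subtype_le _ _))
    have hvW : v ∉ W := by
      intro h
      obtain ⟨c, hc, hcv⟩ := hH'C (hW h)
      have : c ∈ Submodule.span k {(⟨v, hvE₁⟩ : E₁)} := by
        rw [Submodule.mem_span_singleton]
        exact ⟨1, by rw [one_smul]; exact Subtype.ext hcv.symm⟩
      have h0 := Submodule.disjoint_def.1 hC.disjoint c this hc
      rw [h0] at hcv
      exact hv0 (by simpa using hcv.symm)
    refine ⟨W ⊔ Submodule.span k {v}, sup_le (hWE.trans inf_le_left)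
      ((Submodule.span_singleton_le_iff_mem _ _).2 hvH), ?_, ?_⟩
    · have := Submodule.finrank_sup_add_finrank_inf_eq W (Submodule.span k {v})
      have hinf : W ⊓ Submodule.span k {v} = ⊥ :=
        (Submodule.disjoint_span_singleton' hv0).2 hvW |>.eq_bot
      rw [hinf, finrank_bot, finrank_span_singleton hv0, hWr] at this
      omega
    · intro a ha b hb
      obtain ⟨a', ha', x, hx, rfl⟩ := Submodule.mem_sup.1 ha
      obtain ⟨b', hb', y, hy, rfl⟩ := Submodule.mem_sup.1 hb
      obtain ⟨c, rfl⟩ := Submodule.mem_span_singleton.1 hx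
      obtain ⟨d, rfl⟩ := Submodule.mem_span_singleton.1 hy
      have p1 : b₁ v a' = 0 := (hWE ha').2
      have p2 : b₁ v b' = 0 := (hWE hb').2
      have p3 : b₀ v a' = 0 := hv a' (hWE ha').1
      have p4 : b₀ v b' = 0 := hv b' (hWE hb').1
      simp [h₀ v, h₁ v, hWi a' ha' b' hb', p2, p4, symm_of_isAlt h₀ a' v,
        symm_of_isAlt h₁ a' v, p1, p3]

end Isotropic

/-! ### The single Kronecker block -/

section Chain

variable {k V Z : Type*} [Field k] [AddCommGroup V] [Module k V] [FiniteDimensional k V]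
  [AddCommGroup Z] [Module k Z] [FiniteDimensional k Z]

/-- The basis of `V` is a chain with `A f_i = B f_{i+1}`, and that of `Z` is `B f_0, …, B f_{m-1}, A
f_{m-1}`. A linear dependence in either list would produce a subspace `S` that `hns` forbids. -/
theorem exists_kronecker_bases {m : ℕ} (hV : Module.finrank k V = m)
    (hZ : Module.finrank k Z = m + 1) (A B : V →ₗ[k] Z) (hB : Function.Injective B)
    (hns : ∀ S : Submodule k V, S ≠ ⊥ → ¬ S.map A ≤ S.map B) :
    ∃ (f : Module.Basis (Fin m) k V) (x : Module.Basis (Fin (m + 1)) k Z),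
      ∀ i, B (f i) = x i.castSucc ∧ A (f i) = x i.succ := by
  rcases m with _ | n
  · exact ⟨Module.finBasisOfFinrankEq k V hV, Module.finBasisOfFinrankEq k Z hZ,
      fun i => i.elim0⟩
  let Φ : (Fin (n + 1) → V) →ₗ[k] (Fin n → Z) :=
    LinearMap.pi fun i => A ∘ₗ LinearMap.proj i.castSucc - B ∘ₗ LinearMap.proj i.succ
  -- Chains form the kernel of `Φ`, which is nonzero since `(n+1)² > n(n+2)`.
  have hker : LinearMap.ker Φ ≠ ⊥ := by
    apply LinearMap.ker_ne_bot_of_finrank_lt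
    rw [Module.finrank_pi_fintype, Module.finrank_pi_fintype]
    simp only [hV, hZ, Finset.sum_const, Finset.card_univ, Fintype.card_fin, smul_eq_mul]
    nlinarith
  obtain ⟨f, hfker, hf0⟩ := Submodule.exists_mem_ne_zero_of_ne_bot hker
  have hf : ∀ i : Fin n, A (f i.castSucc) = B (f i.succ) := fun i => by
    have := congrFun (LinearMap.mem_ker.1 hfker) i
    exact sub_eq_zero.1 this
  have h0 : f 0 ≠ 0 := by
    intro h
    apply hf0
    funext i
    induction i using Fin.induction with
    | zero => exact h
    | succ i ih => exact hB (by rw [← hf, ih]; simp)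
  have hli : ∀ j (hj : j ≤ n + 1), LinearIndependent k fun i : Fin j => f (Fin.castLE hj i) := by
    intro j
    induction j with
    | zero => intro _; exact linearIndependent_empty_type
    | succ j ih =>
      intro hj
      have ih' := ih (by omega)
      have hsn : (fun i : Fin (j + 1) => f (Fin.castLE hj i)) =
          Fin.snoc (fun i : Fin j => f (Fin.castLE (by omega) i)) (f ⟨j, by omega⟩) := by
        funext i
        refine Fin.lastCases ?_ (fun i => ?_) i
        · simp only [Fin.snoc_last]; rfl
        · simp only [Fin.snoc_castSucc]; rfl
      rw [hsn, linearIndependent_finSnoc]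
      refine ⟨ih', fun hmem => ?_⟩
      rcases j with _ | j
      · simp at hmem
        exact h0 hmem
      -- If `f_{j+1}` lies in the span of `f_0, …, f_j`, then `A` maps this span into its image
      -- under `B`.
      · refine hns (Submodule.span k (Set.range fun i : Fin (j + 1) =>
          f (Fin.castLE (by omega) i))) ?_ ?_
        · intro hbot
          apply h0
          have : f 0 ∈ Submodule.span k (Set.range fun i : Fin (j + 1) =>
              f (Fin.castLE (by omega : j + 1 ≤ n + 1) i)) :=
            Submodule.subset_span ⟨0, rfl⟩
          rw [hbot] at this
          simpa using this
        · rw [Submodule.map_span, Submodule.span_le]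
          rintro _ ⟨_, ⟨i, rfl⟩, rfl⟩
          have e := hf ⟨i.1, by omega⟩
          refine ⟨f ⟨i.1 + 1, by omega⟩, ?_, e.symm⟩
          by_cases hi : i.1 = j
          · have : (⟨i.1 + 1, by omega⟩ : Fin (n + 1)) = ⟨j + 1, by omega⟩ := by
              ext; simp [hi]
            rw [this]
            exact hmem
          · exact Submodule.subset_span ⟨⟨i.1 + 1, by omega⟩, rfl⟩
  have hfl : LinearIndependent k f := hli (n + 1) le_rfl
  let fb : Module.Basis (Fin (n + 1)) k V :=
    basisOfLinearIndependentOfCardEqFinrank hfl (by simp [hV])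
  have hfb : ∀ i, fb i = f i := fun i => by simp [fb]
  have hxl : LinearIndependent k (Fin.snoc (fun i => B (f i)) (A (f (Fin.last n))) :
      Fin (n + 1 + 1) → Z) := by
    rw [linearIndependent_finSnoc]
    refine ⟨hfl.map' B (LinearMap.ker_eq_bot.2 hB), fun hmem => ?_⟩
    have htop : Submodule.span k (Set.range f) = ⊤ := by
      rw [← fb.span_eq]; congr 1; ext; simp [hfb]
    have hr : Submodule.span k (Set.range fun i => B (f i)) = (⊤ : Submodule k V).map B := by
      rw [← htop, Submodule.map_span, ← Set.range_comp]; rfl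
    rw [hr] at hmem
    refine hns ⊤ ?_ ?_
    · intro h
      apply h0
      have : f 0 ∈ (⊤ : Submodule k V) := trivial
      rw [h] at this
      simpa using this
    · conv_lhs => rw [← htop]
      rw [Submodule.map_span, Submodule.span_le]
      rintro _ ⟨_, ⟨i, rfl⟩, rfl⟩
      refine Fin.lastCases ?_ (fun i => ?_) i
      · exact hmem
      · rw [hf]; exact ⟨_, trivial, rfl⟩
  let xb : Module.Basis (Fin (n + 1 + 1)) k Z :=
    basisOfLinearIndependentOfCardEqFinrank hxl (by simp [hZ])
  refine ⟨fb, xb, fun i => ⟨?_, ?_⟩⟩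
  · simp [hfb, xb]
  · simp only [hfb, xb, coe_basisOfLinearIndependentOfCardEqFinrank]
    refine Fin.lastCases ?_ (fun i => ?_) i
    · rw [Fin.succ_last, Fin.snoc_last]
    · rw [hf, Fin.succ_castSucc, Fin.snoc_castSucc]

end Chain

/-! ### Kronecker bases of a pair of alternating forms -/

section Kronecker

variable {k E : Type*} [Field k] [AddCommGroup E] [Module k E]

/-- A basis `e₀, …, e_m, f₀, …, f_{m-1}` with respect to which the `e_i` span a totally isotropic
subspace and `b₀(f_i, e_{i+1}) = 1`, `b₁(f_i, e_i) = 1` are the only nonzero values on pairs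
`(f_i, e_j)`. -/
def IsKroneckerBasis (b₀ b₁ : E →ₗ[k] E →ₗ[k] k) {m : ℕ}
    (v : Module.Basis (Fin (m + 1) ⊕ Fin m) k E) : Prop :=
  (∀ i j, b₀ (v (Sum.inl i)) (v (Sum.inl j)) = 0 ∧ b₁ (v (Sum.inl i)) (v (Sum.inl j)) = 0) ∧
  (∀ i j, b₀ (v (Sum.inr i)) (v (Sum.inl j)) = if j = i.succ then 1 else 0) ∧
  (∀ i j, b₁ (v (Sum.inr i)) (v (Sum.inl j)) = if j = i.castSucc then 1 else 0)

theorem polarBilin_isAlt [CharP k 2] (q : QuadraticForm k E) : q.polarBilin.IsAlt := by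
  intro v
  rw [QuadraticMap.polarBilin_apply_apply, QuadraticMap.polar_self, two_smul,
    CharTwo.add_self_eq_zero]

theorem one_tmul_ne_zero (K : Type*) [Field K] [Algebra k K] {v : E} (hv : v ≠ 0) :
    (1 : K) ⊗ₜ[k] v ≠ 0 := by
  intro h
  apply hv
  exact Module.FaithfullyFlat.tensorProduct_mk_injective (A := k) (B := K) E
    (by rw [TensorProduct.mk_apply, h, map_zero])

theorem finrank_map_of_injOn {Z : Type*} [AddCommGroup Z] [Module k Z] {f : E →ₗ[k] Z}
    {S : Submodule k E} (h : ∀ v ∈ S, f v = 0 → v = 0) :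
    Module.finrank k (S.map f) = Module.finrank k S := by
  rw [← LinearMap.range_domRestrict]
  apply LinearMap.finrank_range_of_inj
  rw [← LinearMap.ker_eq_bot, LinearMap.ker_eq_bot']
  exact fun v hv => Subtype.ext (h v v.2 hv)

variable [FiniteDimensional k E]

theorem exists_isKroneckerBasis {b₀ b₁ : E →ₗ[k] E →ₗ[k] k} {m : ℕ} {W C : Submodule k E}
    (hWC : IsCompl W C) (hWr : Module.finrank k W = m + 1) (hCr : Module.finrank k C = m)
    (hW : ∀ v ∈ W, ∀ w ∈ W, b₀ v w = 0 ∧ b₁ v w = 0)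
    (hinj : ∀ v ∈ C, (∀ w ∈ W, b₁ v w = 0) → v = 0)
    (hns : ∀ S ≤ C, S ≠ ⊥ → ¬ ∀ v ∈ S, ∃ u ∈ S, ∀ w ∈ W, b₀ v w = b₁ u w) :
    ∃ v : Module.Basis (Fin (m + 1) ⊕ Fin m) k E,
      IsKroneckerBasis b₀ b₁ v ∧ ∀ j, v (Sum.inr j) ∈ C := by
  let A : C →ₗ[k] Module.Dual k W := b₀.compl₁₂ C.subtype W.subtype
  let B : C →ₗ[k] Module.Dual k W := b₁.compl₁₂ C.subtype W.subtype
  have hA : ∀ (c : C) (w : W), A c w = b₀ c w := fun _ _ => rfl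
  have hB : ∀ (c : C) (w : W), B c w = b₁ c w := fun _ _ => rfl
  obtain ⟨f, x, hfx⟩ := exists_kronecker_bases (m := m) hCr
    (by rw [Subspace.dual_finrank_eq, hWr]) A B
    (by
      rw [← LinearMap.ker_eq_bot, LinearMap.ker_eq_bot']
      intro c hc
      exact Subtype.ext (hinj c c.2 fun w hw => by
        rw [← hB c ⟨w, hw⟩, hc]; rfl))
    (by
      intro S hS hle
      refine hns (S.map C.subtype) (Submodule.map_subtype_le _ _) ?_ ?_
      · intro h
        exact hS (Submodule.map_injective_of_injective C.injective_subtype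
          (by rw [h, Submodule.map_bot]))
      · rintro _ ⟨s, hs, rfl⟩
        obtain ⟨u, hu, hus⟩ := hle ⟨s, hs, rfl⟩
        refine ⟨u, ⟨u, hu, rfl⟩, fun w hw => ?_⟩
        exact (LinearMap.congr_fun hus ⟨w, hw⟩).symm)
  -- The basis of `W` to which `x` is dual, obtained through biduality.
  let e : Module.Basis (Fin (m + 1)) k W := x.dualBasis.map (Module.evalEquiv k W).symm
  have hxe : ∀ i j, x i (e j) = if j = i then 1 else 0 := by
    intro i j
    have h1 : Module.evalEquiv k W (e j) = x.dualBasis j := by simp [e]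
    have h2 : Module.evalEquiv k W (e j) (x i) = x i (e j) := by simp
    rw [← h2, h1, Module.Basis.dualBasis_apply_self]
    simp only [eq_comm]
  let v : Module.Basis (Fin (m + 1) ⊕ Fin m) k E :=
    (e.prod f).map (Submodule.prodEquivOfIsCompl W C hWC)
  have hvl : ∀ i, v (Sum.inl i) = e i := fun i => by simp [v]
  have hvr : ∀ i, v (Sum.inr i) = f i := fun i => by simp [v]
  refine ⟨v, ⟨fun i j => ?_, fun i j => ?_, fun i j => ?_⟩, fun j => ?_⟩
  · rw [hvl, hvl]; exact hW _ (e i).2 _ (e j).2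
  · rw [hvl, hvr, ← hA, (hfx i).2, hxe]
  · rw [hvl, hvr, ← hB, (hfx i).1, hxe]
  · rw [hvr]; exact (f j).2

theorem exists_endomorphism {S Z : Type*} [AddCommGroup S] [Module k S] [AddCommGroup Z]
    [Module k Z] (A B : S →ₗ[k] Z) (hB : Function.Injective B) (h : ∀ v, ∃ u, A v = B u) :
    ∃ T : S →ₗ[k] S, ∀ v, A v = B (T v) := by
  let e := LinearEquiv.ofInjective B hB
  let A' : S →ₗ[k] LinearMap.range B :=
    A.codRestrict _ fun v => by obtain ⟨u, hu⟩ := h v; exact ⟨u, hu.symm⟩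
  refine ⟨e.symm.toLinearMap ∘ₗ A', fun v => ?_⟩
  have : e (e.symm (A' v)) = A' v := e.apply_symm_apply _
  have h2 := congrArg Subtype.val this
  simp only [e, LinearEquiv.ofInjective_apply] at h2
  exact h2.symm

theorem exists_eigenvector {S Z : Type*} [IsAlgClosed k] [AddCommGroup S] [Module k S]
    [FiniteDimensional k S] [Nontrivial S] [AddCommGroup Z]
    [Module k Z] (A B : S →ₗ[k] Z) (hB : Function.Injective B) (h : ∀ v, ∃ u, A v = B u) :
    ∃ (c : k) (v : S), v ≠ 0 ∧ A v = c • B v := by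
  obtain ⟨T, hT⟩ := exists_endomorphism A B hB h
  obtain ⟨c, hc⟩ := Module.End.exists_eigenvalue T
  obtain ⟨v, hv⟩ := hc.exists_hasEigenvector
  exact ⟨c, v, hv.2, by rw [hT, hv.apply_eq_smul, map_smul]⟩

end Kronecker

/-! ### Kronecker bases adapted to a subspace of X -/

section QuasiSplit

variable {k E : Type*} [Field k] [AddCommGroup E] [Module k E] [FiniteDimensional k E]

theorem polarBilin_eq_zero_of_isRegularPair {q₀ q₁ : QuadraticForm k E}
    (hreg : IsRegularPair q₀ q₁) {v : AlgebraicClosure k ⊗[k] E}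
    (h₀ : extendScalars (AlgebraicClosure k) q₀ v = 0)
    (h₁ : extendScalars (AlgebraicClosure k) q₁ v = 0) {s t : AlgebraicClosure k}
    (hst : s ≠ 0 ∨ t ≠ 0)
    (h : ∀ u, s * (extendScalars (AlgebraicClosure k) q₀).polarBilin v u +
      t * (extendScalars (AlgebraicClosure k) q₁).polarBilin v u = 0) : v = 0 := by
  by_contra hv
  have := LinearIndependent.pair_iff.1 (hreg v hv h₀ h₁) s t (LinearMap.ext fun u => by
    simpa using h u)
  rcases hst with h | h
  · exact h this.1
  · exact h this.2

theorem extendScalars_eq_zero_of_liesOn {q₀ q₁ : QuadraticForm k E} {L : Submodule k E}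
    (hL : LiesOn q₀ q₁ (L.baseChange (AlgebraicClosure k))) {v : E} (hv : v ∈ L) :
    q₀ v = 0 ∧ q₁ v = 0 := by
  have h := hL (1 ⊗ₜ v) (Submodule.tmul_mem_baseChange_of_mem _ hv)
  rw [extendScalars_tmul, extendScalars_tmul] at h
  simpa using h

theorem polarBilin_injOn_of_liesOn {q₀ q₁ : QuadraticForm k E} (hreg : IsRegularPair q₀ q₁)
    {L : Submodule k E} (hL : LiesOn q₀ q₁ (L.baseChange (AlgebraicClosure k))) {v : E}
    (hv : v ∈ L) (h : ∀ u, q₁.polarBilin v u = 0) : v = 0 := by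
  by_contra hv0
  have h1 := hL (1 ⊗ₜ v) (Submodule.tmul_mem_baseChange_of_mem _ hv)
  refine one_tmul_ne_zero (AlgebraicClosure k) hv0
    (polarBilin_eq_zero_of_isRegularPair hreg h1.1 h1.2 (s := 0) (t := 1)
      (Or.inr one_ne_zero) fun u => ?_)
  rw [zero_mul, zero_add, one_mul]
  induction u with
  | zero => simp
  | add x y hx hy => rw [map_add, hx, hy, add_zero]
  | tmul c u =>
    rw [QuadraticMap.polarBilin_apply_apply, polar_extendScalars_tmul]
    have := h u
    rw [QuadraticMap.polarBilin_apply_apply] at this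
    rw [this]; simp

/-- Otherwise `b₀(v, ·) = b₁(T v, ·)` for an endomorphism `T` of `S`. An eigenvector of `T` over the
algebraic closure is a point of `X` where a nontrivial combination of the two differentials
vanishes. -/
theorem not_forall_exists_polarBilin_eq {q₀ q₁ : QuadraticForm k E} (hreg : IsRegularPair q₀ q₁)
    {L : Submodule k E} (hL : LiesOn q₀ q₁ (L.baseChange (AlgebraicClosure k)))
    {S : Submodule k E} (hSL : S ≤ L) (hS : S ≠ ⊥) :
    ¬ ∀ v ∈ S, ∃ u ∈ S, q₀.polarBilin v = q₁.polarBilin u := by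
  intro h
  set K := AlgebraicClosure k
  have hBinj : Function.Injective (q₁.polarBilin ∘ₗ S.subtype) := by
    rw [← LinearMap.ker_eq_bot, LinearMap.ker_eq_bot']
    intro c hc
    exact Subtype.ext (polarBilin_injOn_of_liesOn hreg hL (hSL c.2)
      fun u => LinearMap.congr_fun hc u)
  obtain ⟨T, hT⟩ := exists_endomorphism (q₀.polarBilin ∘ₗ S.subtype) (q₁.polarBilin ∘ₗ S.subtype)
    hBinj (fun v => by
      obtain ⟨u, hu, hvu⟩ := h v v.2
      exact ⟨⟨u, hu⟩, hvu⟩)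
  have hnt : Nontrivial S := Submodule.nontrivial_iff_ne_bot.2 hS
  have hntK : Nontrivial (K ⊗[k] S) := by
    obtain ⟨s, hs⟩ := exists_ne (0 : S)
    exact ⟨1 ⊗ₜ s, 0, one_tmul_ne_zero K hs⟩
  obtain ⟨c, hc⟩ := Module.End.exists_eigenvalue (T.baseChange K)
  obtain ⟨w, hw⟩ := hc.exists_hasEigenvector
  have hι : Function.Injective (S.subtype.baseChange K) :=
    Module.Flat.lTensor_preserves_injective_linearMap (M := K) S.subtype S.injective_subtype
  have hmem : ∀ w, S.subtype.baseChange K w ∈ L.baseChange K := by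
    intro w
    induction w with
    | zero => simp
    | add x y hx hy => rw [map_add]; exact add_mem hx hy
    | tmul c u =>
      rw [LinearMap.baseChange_tmul]
      exact Submodule.tmul_mem_baseChange_of_mem _ (hSL u.2)
  have hpol : ∀ w u, (extendScalars K q₀).polarBilin (S.subtype.baseChange K w) u =
      (extendScalars K q₁).polarBilin (S.subtype.baseChange K (T.baseChange K w)) u := by
    intro w u
    induction w with
    | zero => simp
    | add x y hx hy => simp only [map_add, LinearMap.add_apply, hx, hy]
    | tmul c s =>
      induction u with
      | zero => simp
      | add x y hx hy => rw [map_add, map_add, hx, hy]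
      | tmul d u =>
        rw [LinearMap.baseChange_tmul, LinearMap.baseChange_tmul, LinearMap.baseChange_tmul,
          QuadraticMap.polarBilin_apply_apply, QuadraticMap.polarBilin_apply_apply,
          polar_extendScalars_tmul, polar_extendScalars_tmul]
        have := LinearMap.congr_fun (hT s) u
        simp only [LinearMap.comp_apply, QuadraticMap.polarBilin_apply_apply] at this
        rw [this]
  have h1 := hL _ (hmem w)
  refine hw.2 (hι ?_)
  rw [map_zero]
  refine polarBilin_eq_zero_of_isRegularPair hreg h1.1 h1.2 (s := 1) (t := -c)
    (Or.inl one_ne_zero) fun u => ?_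
  rw [hpol, hw.apply_eq_smul, map_smul, map_smul, LinearMap.smul_apply, smul_eq_mul]
  ring

/-- The main point is `W ∩ L = 0`. Both polar forms map `W ∩ L` into the annihilator of `W + L`,
whose dimension equals that of `W ∩ L` because `dim W + dim L = dim E`. As `b₁` is injective there,
it fills the annihilator, so `b₀(W ∩ L) ⊆ b₁(W ∩ L)`, which regularity excludes unless `W ∩ L` is
zero. -/
theorem exists_isKroneckerBasis_of_liesOn [CharP k 2] {m : ℕ}
    (hE : Module.finrank k E = 2 * m + 1) {q₀ q₁ : QuadraticForm k E}
    (hreg : IsRegularPair q₀ q₁) {L : Submodule k E}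
    (hL : LiesOn q₀ q₁ (L.baseChange (AlgebraicClosure k))) (hLm : Module.finrank k L = m) :
    ∃ v : Module.Basis (Fin (m + 1) ⊕ Fin m) k E,
      IsKroneckerBasis q₀.polarBilin q₁.polarBilin v ∧ ∀ j, v (Sum.inr j) ∈ L := by
  have hpolL : ∀ v ∈ L, ∀ w ∈ L, q₀.polarBilin v w = 0 ∧ q₁.polarBilin v w = 0 := by
    intro v hv w hw
    have h1 := extendScalars_eq_zero_of_liesOn hL hv
    have h2 := extendScalars_eq_zero_of_liesOn hL hw
    have h3 := extendScalars_eq_zero_of_liesOn hL (add_mem hv hw)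
    simp [QuadraticMap.polar, h1, h2, h3]
  obtain ⟨W, -, hWr, hW⟩ := exists_isotropic (polarBilin_isAlt q₀) (polarBilin_isAlt q₁) m ⊤
    (by rw [finrank_top, hE])
  have hinf : W ⊓ L = ⊥ := by
    by_contra hne
    refine not_forall_exists_polarBilin_eq hreg hL (inf_le_right : W ⊓ L ≤ L) hne ?_
    have hann : ∀ q : QuadraticForm k E, (∀ v ∈ W, ∀ w ∈ W, q.polarBilin v w = 0) →
        (∀ v ∈ L, ∀ w ∈ L, q.polarBilin v w = 0) →
        (W ⊓ L).map q.polarBilin ≤ (W ⊔ L).dualAnnihilator := by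
      rintro q h1 h2 _ ⟨v, hv, rfl⟩
      rw [Submodule.mem_dualAnnihilator]
      intro u hu
      obtain ⟨w, hw, l, hl, rfl⟩ := Submodule.mem_sup.1 hu
      rw [map_add, h1 v hv.1 w hw, h2 v hv.2 l hl, add_zero]
    have hmap : (W ⊓ L).map q₁.polarBilin = (W ⊔ L).dualAnnihilator := by
      apply Submodule.eq_of_le_of_finrank_eq
      · exact hann q₁ (fun v hv w hw => (hW v hv w hw).2) (fun v hv w hw => (hpolL v hv w hw).2)
      · have e1 := Submodule.finrank_sup_add_finrank_inf_eq W L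
        have e2 := Subspace.finrank_add_finrank_dualAnnihilator_eq (W ⊔ L)
        refine (finrank_map_of_injOn fun v hv h => ?_).trans ?_
        · exact polarBilin_injOn_of_liesOn hreg hL hv.2 fun u => LinearMap.congr_fun h u
        · exact (by omega : Module.finrank k (W ⊓ L : Submodule k E) =
            Module.finrank k (W ⊔ L).dualAnnihilator)
    intro v hv
    have : q₀.polarBilin v ∈ (W ⊓ L).map q₁.polarBilin := by
      rw [hmap]
      exact hann q₀ (fun v hv w hw => (hW v hv w hw).1) (fun v hv w hw => (hpolL v hv w hw).1)
        ⟨v, hv, rfl⟩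
    obtain ⟨u, hu, huv⟩ := this
    exact ⟨u, hu, huv.symm⟩
  have hcompl : IsCompl W L := by
    refine ⟨disjoint_iff.2 hinf, codisjoint_iff.2 ?_⟩
    apply Submodule.eq_top_of_finrank_eq
    have e1 := Submodule.finrank_sup_add_finrank_inf_eq W L
    rw [hinf, finrank_bot] at e1
    omega
  have hext : ∀ (q : QuadraticForm k E), (∀ v ∈ L, ∀ w ∈ L, q.polarBilin v w = 0) →
      ∀ v ∈ L, ∀ u, ∃ w ∈ W, q.polarBilin v u = q.polarBilin v w := by
    intro q hq v hv u
    have hu : u ∈ W ⊔ L := by rw [hcompl.sup_eq_top]; trivial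
    obtain ⟨w, hw, l, hl, rfl⟩ := Submodule.mem_sup.1 hu
    exact ⟨w, hw, by rw [map_add, hq v hv l hl, add_zero]⟩
  refine exists_isKroneckerBasis hcompl hWr hLm hW ?_ ?_
  · intro v hv h
    refine polarBilin_injOn_of_liesOn hreg hL hv fun u => ?_
    obtain ⟨w, hw, e⟩ := hext q₁ (fun v hv w hw => (hpolL v hv w hw).2) v hv u
    rw [e, h w hw]
  · intro S hSL hS h
    refine not_forall_exists_polarBilin_eq hreg hL hSL hS fun v hv => ?_
    obtain ⟨u, hu, hvu⟩ := h v hv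
    refine ⟨u, hu, LinearMap.ext fun z => ?_⟩
    have hz : z ∈ W ⊔ L := by rw [hcompl.sup_eq_top]; trivial
    obtain ⟨w, hw, l, hl, rfl⟩ := Submodule.mem_sup.1 hz
    rw [map_add, map_add, hvu w hw, (hpolL v (hSL hv) l hl).1, (hpolL u (hSL hu) l hl).2]

end QuasiSplit

/-! ### The adjugate of an alternating Kronecker pencil -/

section Adjugate

open Matrix

variable {R : Type*} [CommRing R]

theorem adjugate_diag_eq_det {ι : Type*} [Fintype ι] [DecidableEq ι] (M : Matrix ι ι R) (i : ι) :
    M.adjugate i i =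
      (M.submatrix (fun j : {j : ι // j ≠ i} => j.1) (fun j : {j : ι // j ≠ i} => j.1)).det := by
  rw [adjugate_apply, twoBlockTriangular_det _ (fun j => j ≠ i)]
  · have h2 : (toSquareBlockProp (M.updateRow i (Pi.single i 1)) fun j => ¬ j ≠ i).det = 1 := by
      have : Subsingleton {j // ¬ j ≠ i} :=
        ⟨fun a b => Subtype.ext ((not_not.1 a.2).trans (not_not.1 b.2).symm)⟩
      rw [det_eq_elem_of_subsingleton _ ⟨i, not_not.2 rfl⟩]
      simp [toSquareBlockProp]
    rw [h2, mul_one]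
    congr 1
    ext a b
    simp [toSquareBlockProp, a.2]
  · intro a ha b hb
    rw [not_not.1 ha]
    simp [hb]

/-- The matrix of the maps in the pencil of the Kronecker block of size `(m + 1) × m`. -/
def kroneckerBlock (m : ℕ) (t₀ t₁ : R) : Matrix (Fin (m + 1)) (Fin m) R :=
  Matrix.of fun i j => t₀ * (if i = j.succ then 1 else 0) + t₁ * (if i = j.castSucc then 1 else 0)

/-- The coordinates of the vector that spans the radical of an alternating Kronecker pencil. -/
def kroneckerVec (m : ℕ) (t₀ t₁ : R) : Fin (m + 1) ⊕ Fin m → R :=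
  Sum.elim (fun i => t₀ ^ (m - i.1) * t₁ ^ i.1) 0

theorem det_kroneckerBlock_succ (m : ℕ) (t₀ t₁ : R) :
    ((kroneckerBlock m t₀ t₁).submatrix Fin.succ id).det = t₀ ^ m := by
  rw [det_of_isUpperTriangular]
  · have : ∀ i, (kroneckerBlock m t₀ t₁).submatrix Fin.succ id i i = t₀ := by
      intro i
      have : i.succ ≠ i.castSucc := by simp [Fin.ext_iff]
      simp [kroneckerBlock, this]
    rw [Finset.prod_congr rfl fun i _ => this i]
    simp
  · intro i j hij
    have hij' : j < i := hij
    have h1 : i.succ ≠ j.castSucc := by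
      simp only [ne_eq, Fin.ext_iff, Fin.val_succ, Fin.val_castSucc]
      have : j.1 < i.1 := hij'
      omega
    simp [kroneckerBlock, h1, hij'.ne']

/-- Deleting the row and column of `e_0` leaves two off-diagonal square blocks, each of determinant
`t₀ ^ m`. The sign of the block swap does not matter in characteristic 2. -/
theorem adjugate_kronecker_corner [CharP R 2] (m : ℕ) (t₀ t₁ : R) :
    (fromBlocks 0 (kroneckerBlock m t₀ t₁) (kroneckerBlock m t₀ t₁)ᵀ 0).adjugate
      (Sum.inl 0) (Sum.inl 0) = t₀ ^ (2 * m) := by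
  rw [adjugate_diag_eq_det]
  let g : Fin m ⊕ Fin m → {s : Fin (m + 1) ⊕ Fin m // s ≠ Sum.inl 0} :=
    Sum.elim (fun i => ⟨Sum.inl i.succ, by simp⟩) (fun j => ⟨Sum.inr j, by simp⟩)
  have hg : Function.Bijective g := by
    constructor
    · rintro (a | a) (b | b) h <;> simp [g] at h ⊢ <;> exact h
    · rintro ⟨a | a, ha⟩
      · obtain ⟨b, rfl⟩ := Fin.exists_succ_eq.2 (fun h : a = 0 => ha (by rw [h]))
        exact ⟨Sum.inl b, rfl⟩
      · exact ⟨Sum.inr a, rfl⟩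
  rw [← det_submatrix_equiv_self (Equiv.ofBijective g hg)]
  set X := (kroneckerBlock m t₀ t₁).submatrix Fin.succ id with hX
  have hM : ((fromBlocks 0 (kroneckerBlock m t₀ t₁) (kroneckerBlock m t₀ t₁)ᵀ 0).submatrix
      (fun j : {j // j ≠ Sum.inl 0} => j.1) (fun j : {j // j ≠ Sum.inl 0} => j.1)).submatrix
      (Equiv.ofBijective g hg) (Equiv.ofBijective g hg) = fromBlocks 0 X Xᵀ 0 := by
    ext (a | a) (b | b) <;> simp [g, hX]
  rw [hM]
  have hperm := det_permute' (Equiv.sumComm (Fin m) (Fin m)) (fromBlocks 0 X Xᵀ 0)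
  have hsub : (fromBlocks 0 X Xᵀ 0).submatrix id (Equiv.sumComm (Fin m) (Fin m)) =
      fromBlocks X 0 0 Xᵀ := by
    ext (a | a) (b | b) <;> simp
  rw [hsub, det_fromBlocks_zero₂₁, det_transpose, det_kroneckerBlock_succ] at hperm
  have hsign : ((Equiv.Perm.sign (Equiv.sumComm (Fin m) (Fin m)) : ℤ) : R) = 1 := by
    rcases Int.units_eq_one_or (Equiv.Perm.sign (Equiv.sumComm (Fin m) (Fin m))) with h | h <;>
      rw [h] <;> simp [CharTwo.neg_eq]
  rw [hsign, one_mul] at hperm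
  rw [← hperm, ← pow_add, two_mul]

/-- The determinant vanishes since the size is odd, so the columns of the adjugate lie in the kernel
of the matrix. Solving recursively shows that they are proportional to `kroneckerVec`; symmetry and
the corner entry fix the factor. -/
theorem adjugate_kronecker [IsDomain R] [CharP R 2] (m : ℕ) (t₀ t₁ : R) (h₀ : t₀ ≠ 0) :
    (fromBlocks 0 (kroneckerBlock m t₀ t₁) (kroneckerBlock m t₀ t₁)ᵀ 0).adjugate =
      vecMulVec (kroneckerVec m t₀ t₁) (kroneckerVec m t₀ t₁) := by
  set Y := kroneckerBlock m t₀ t₁ with hY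
  set M : Matrix (Fin (m + 1) ⊕ Fin m) (Fin (m + 1) ⊕ Fin m) R := fromBlocks 0 Y Yᵀ 0 with hM
  have hsymm : Mᵀ = M := by simp [hM, fromBlocks_transpose]
  have hadj : ∀ a b, M.adjugate a b = M.adjugate b a := fun a b => by
    conv_lhs => rw [← hsymm, ← adjugate_transpose]
    rfl
  have hdet : M.det = 0 := by
    refine det_eq_zero_of_odd_card M (fun a b => congrFun (congrFun hsymm b) a) ?_ ?_
    · rintro (a | a) <;> simp [hM]
    · simp only [Fintype.card_sum, Fintype.card_fin]; exact ⟨m, by ring⟩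
  have hcol : ∀ b, M *ᵥ (fun a => M.adjugate a b) = 0 := fun b => by
    have := M.mul_adjugate
    rw [hdet, zero_smul] at this
    funext a
    exact congrFun (congrFun this a) b
  have hr : ∀ b j, M.adjugate (Sum.inr j) b = 0 := by
    intro b
    have hz : (Y.submatrix Fin.succ id) *ᵥ (fun j => M.adjugate (Sum.inr j) b) = 0 := by
      funext i
      have := congrFun (hcol b) (Sum.inl i.succ)
      simpa [Matrix.mulVec, dotProduct, hM] using this
    have := eq_zero_of_mulVec_eq_zero (by
      rw [hY, det_kroneckerBlock_succ]; exact pow_ne_zero _ h₀) hz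
    exact congrFun this
  have hstep : ∀ b (j : Fin m), t₀ * M.adjugate (Sum.inl j.succ) b =
      t₁ * M.adjugate (Sum.inl j.castSucc) b := by
    intro b j
    have key : ∀ c : Fin (m + 1) ⊕ Fin m → R, (M *ᵥ c) (Sum.inr j) =
        t₀ * c (Sum.inl j.succ) + t₁ * c (Sum.inl j.castSucc) := by
      intro c
      simp [Matrix.mulVec, dotProduct, hM, hY, kroneckerBlock, add_mul, Finset.sum_add_distrib]
    rw [← CharTwo.add_eq_zero, ← key fun a => M.adjugate a b, hcol]
    rfl
  have hpow : ∀ b (i : Fin (m + 1)), t₀ ^ i.1 * M.adjugate (Sum.inl i) b =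
      t₁ ^ i.1 * M.adjugate (Sum.inl 0) b := by
    intro b i
    induction i using Fin.induction with
    | zero => simp
    | succ j ih =>
      rw [Fin.val_succ, pow_succ, mul_assoc, hstep, mul_left_comm]
      rw [Fin.val_castSucc] at ih
      rw [ih]; ring
  have h00 : M.adjugate (Sum.inl 0) (Sum.inl 0) = t₀ ^ (2 * m) := adjugate_kronecker_corner m t₀ t₁
  ext a b
  rw [vecMulVec_apply]
  rcases a with a | a
  · rcases b with b | b
    -- The recursion determines entries only after multiplication by powers of `t₀`, which are
    -- cancelled at the end.
    · apply mul_left_cancel₀ (pow_ne_zero (a.1 + b.1) h₀)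
      simp only [kroneckerVec, Sum.elim_inl]
      calc t₀ ^ (a.1 + b.1) * M.adjugate (Sum.inl a) (Sum.inl b)
          = t₀ ^ b.1 * (t₀ ^ a.1 * M.adjugate (Sum.inl a) (Sum.inl b)) := by ring
        _ = t₁ ^ a.1 * (t₀ ^ b.1 * M.adjugate (Sum.inl b) (Sum.inl 0)) := by
          rw [hpow, hadj]; ring
        _ = t₁ ^ a.1 * t₁ ^ b.1 * t₀ ^ (2 * m) := by rw [hpow, h00]; ring
        _ = t₁ ^ a.1 * t₁ ^ b.1 * (t₀ ^ (m - a.1 + a.1) * t₀ ^ (m - b.1 + b.1)) := by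
          rw [Nat.sub_add_cancel (Nat.lt_succ_iff.1 a.2),
            Nat.sub_add_cancel (Nat.lt_succ_iff.1 b.2), two_mul, pow_add]
        _ = _ := by ring
    · rw [hadj, hr]; simp [kroneckerVec]
  · rw [hr]; simp [kroneckerVec]

end Adjugate

/-! ### The half-discriminant in a Kronecker basis -/

section HalfDisc

open Matrix MvPolynomial

variable {k E : Type*} [Field k] [AddCommGroup E] [Module k E]

/-- The matrix over `k[t₀, t₁]` of the pencil `t₀ β₀ + t₁ β₁` of bilinear forms in a basis. -/
noncomputable def pencilMatrix {ι : Type*} [Fintype ι] [DecidableEq ι]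
    (β₀ β₁ : LinearMap.BilinForm k E) (w : Module.Basis ι k E) :
    Matrix ι ι (MvPolynomial (Fin 2) k) :=
  Matrix.of fun i j => X 0 * C (β₀ (w i) (w j)) + X 1 * C (β₁ (w i) (w j))

theorem pencilMatrix_basis_change {ι : Type*} [Fintype ι] [DecidableEq ι]
    (β₀ β₁ : LinearMap.BilinForm k E) (u w : Module.Basis ι k E) :
    pencilMatrix β₀ β₁ w = ((u.toMatrix w).map C)ᵀ * pencilMatrix β₀ β₁ u * (u.toMatrix w).map C := by
  have h : ∀ w : Module.Basis ι k E, pencilMatrix β₀ β₁ w =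
      (X 0 : MvPolynomial (Fin 2) k) • (LinearMap.BilinForm.toMatrix w β₀).map C +
        (X 1 : MvPolynomial (Fin 2) k) • (LinearMap.BilinForm.toMatrix w β₁).map C := by
    intro w
    ext i j : 2
    simp [pencilMatrix]
  rw [h, h, ← LinearMap.BilinForm.toMatrix_mul_basis_toMatrix u w β₀,
    ← LinearMap.BilinForm.toMatrix_mul_basis_toMatrix u w β₁]
  simp only [Matrix.map_mul, Matrix.mul_add, Matrix.add_mul, Matrix.mul_smul, Matrix.smul_mul,
    Matrix.transpose_map]

theorem sum_polar_eq_pencilMatrix {ι : Type*} [Fintype ι] [LinearOrder ι] (e : Module.Basis ι k E)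
    (q₀ q₁ : QuadraticForm k E) (ω : ι → MvPolynomial (Fin 2) k) :
    (∑ p : ι × ι with p.1 ≤ p.2, (X 0 * C (coeffMatrix e q₀ p.1 p.2) +
      X 1 * C (coeffMatrix e q₁ p.1 p.2)) * (ω p.1 * ω p.2)) =
    ω ⬝ᵥ pencilMatrix (q₀.toBilin e) (q₁.toBilin e) e *ᵥ ω := by
  rw [Finset.sum_filter, Fintype.sum_prod_type]
  simp only [dotProduct, Matrix.mulVec, Finset.mul_sum]
  refine Finset.sum_congr rfl fun i _ => Finset.sum_congr rfl fun j _ => ?_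
  simp only [pencilMatrix, coeffMatrix, of_apply, QuadraticMap.toBilin_apply]
  rcases lt_trichotomy i j with h | h | h
  · simp only [h.le, h.ne, h, if_true, if_false]; ring
  · subst h; simp; ring
  · simp [h.not_ge, h.ne', h.not_gt]

/-- Where the polar forms vanish, `β₀` and `β₁` are symmetric in characteristic 2, so the
off-diagonal terms cancel in pairs. -/
theorem dotProduct_pencilMatrix [CharP k 2] {ι : Type*} [Fintype ι] [DecidableEq ι]
    {q₀ q₁ : QuadraticForm k E} {β₀ β₁ : LinearMap.BilinForm k E}
    (h₀ : ∀ v, q₀ v = β₀ v v) (h₁ : ∀ v, q₁ v = β₁ v v) (u : Module.Basis ι k E)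
    (w : ι → MvPolynomial (Fin 2) k)
    (hw : ∀ i j, w i ≠ 0 → w j ≠ 0 → q₀.polarBilin (u i) (u j) = 0 ∧ q₁.polarBilin (u i) (u j) = 0) :
    w ⬝ᵥ pencilMatrix β₀ β₁ u *ᵥ w =
      ∑ i, (X 0 * C (q₀ (u i)) + X 1 * C (q₁ (u i))) * w i ^ 2 := by
  simp only [dotProduct, Matrix.mulVec, Finset.mul_sum]
  rw [← Fintype.sum_prod_type',
    ← Finset.sum_filter_add_sum_filter_not Finset.univ (fun p : ι × ι => p.1 = p.2)]
  have hoff : (∑ p : ι × ι with ¬ p.1 = p.2,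
      w p.1 * (pencilMatrix β₀ β₁ u p.1 p.2 * w p.2)) = 0 := by
    refine Finset.sum_involution (fun p _ => (p.2, p.1)) ?_ ?_ ?_ ?_
    · rintro ⟨i, j⟩ -
      have hp : ∀ (q : QuadraticForm k E) (β : LinearMap.BilinForm k E), (∀ v, q v = β v v) →
          q.polarBilin (u i) (u j) = 0 → β (u j) (u i) = β (u i) (u j) := by
        intro q β hq hz
        rw [QuadraticMap.polarBilin_apply_apply, QuadraticMap.polar, hq, hq, hq] at hz
        simp only [map_add, LinearMap.add_apply] at hz
        have : β (u i) (u j) + β (u j) (u i) = 0 := by linear_combination hz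
        exact (CharTwo.add_eq_zero.1 this).symm
      by_cases hi : w i = 0
      · simp [hi]
      by_cases hj : w j = 0
      · simp [hj]
      obtain ⟨z₀, z₁⟩ := hw i j hi hj
      simp only [pencilMatrix, of_apply]
      rw [hp q₀ β₀ h₀ z₀, hp q₁ β₁ h₁ z₁]
      have : ∀ a : MvPolynomial (Fin 2) k, w i * (a * w j) + w j * (a * w i) = 0 := fun a => by
        rw [mul_left_comm, mul_left_comm (w j), mul_comm (w j), CharTwo.add_self_eq_zero]
      exact this _
    · rintro ⟨i, j⟩ hp _ heq
      simp only [Finset.mem_filter, Finset.mem_univ, true_and] at hp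
      exact hp (congrArg Prod.snd heq)
    · rintro ⟨i, j⟩ hp
      simp only [Finset.mem_filter, Finset.mem_univ, true_and] at hp ⊢
      exact fun h => hp h.symm
    · rintro ⟨i, j⟩ _; rfl
  rw [hoff, add_zero, Finset.sum_filter, Fintype.sum_prod_type]
  simp only [Finset.sum_ite_eq, Finset.mem_univ, if_true]
  refine Finset.sum_congr rfl fun i _ => ?_
  simp only [pencilMatrix, of_apply, ← h₀, ← h₁]
  ring

theorem pencilMatrix_isKroneckerBasis [CharP k 2] {m : ℕ} {q₀ q₁ : QuadraticForm k E}
    {v : Module.Basis (Fin (m + 1) ⊕ Fin m) k E}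
    (hv : IsKroneckerBasis q₀.polarBilin q₁.polarBilin v)
    (hf : ∀ i j, q₀.polarBilin (v (Sum.inr i)) (v (Sum.inr j)) = 0 ∧
      q₁.polarBilin (v (Sum.inr i)) (v (Sum.inr j)) = 0) :
    pencilMatrix q₀.polarBilin q₁.polarBilin v =
      fromBlocks 0 (kroneckerBlock m (X 0) (X 1)) (kroneckerBlock m (X 0) (X 1))ᵀ 0 := by
  ext1 a b
  rcases a with a | a <;> rcases b with b | b
  · simp only [pencilMatrix, of_apply, (hv.1 a b).1, (hv.1 a b).2, map_zero, mul_zero, add_zero,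
      fromBlocks_apply₁₁, Matrix.zero_apply]
  · simp only [pencilMatrix, of_apply, symm_of_isAlt (polarBilin_isAlt _) (v (Sum.inl a)),
      hv.2.1, hv.2.2, fromBlocks_apply₁₂, kroneckerBlock, apply_ite C, map_one, map_zero]
  · simp only [pencilMatrix, of_apply, hv.2.1, hv.2.2, fromBlocks_apply₂₁, transpose_apply,
      kroneckerBlock, apply_ite C, map_one, map_zero]
  · simp only [pencilMatrix, of_apply, (hf a b).1, (hf a b).2, map_zero, mul_zero, add_zero,
      fromBlocks_apply₂₂, Matrix.zero_apply]

theorem omegaCoord_sq [CharP k 2] {ι : Type*} [Fintype ι] [LinearOrder ι] (e : Module.Basis ι k E)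
    (q₀ q₁ : QuadraticForm k E) (i : ι) :
    omegaCoord (Matrix.of fun i j => if i = j then 0 else
      X 0 * C (coeffMatrix e q₀ i j) + X 1 * C (coeffMatrix e q₁ i j)) i ^ 2 =
      (pencilMatrix q₀.polarBilin q₁.polarBilin e).adjugate i i := by
  have hM : (Matrix.of fun i j => if i = j then 0 else
      X 0 * C (coeffMatrix e q₀ i j) + X 1 * C (coeffMatrix e q₁ i j)) =
      pencilMatrix q₀.polarBilin q₁.polarBilin e := by
    ext1 i j
    by_cases h : i = j
    · subst h
      simp [pencilMatrix, polarBilin_isAlt q₀ (e i), polarBilin_isAlt q₁ (e i),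
        -QuadraticMap.polarBilin_apply_apply]
    · simp [pencilMatrix, coeffMatrix, h]
  rw [hM, omegaCoord, pfaffianCharTwo_sq, adjugate_diag_eq_det]
  · congr!
  · intro a b
    simp only [submatrix_apply, pencilMatrix, of_apply]
    rw [symm_of_isAlt (polarBilin_isAlt q₀) (e a), symm_of_isAlt (polarBilin_isAlt q₁) (e a)]
  · intro a
    simp only [submatrix_apply, pencilMatrix, of_apply]
    rw [polarBilin_isAlt q₀, polarBilin_isAlt q₁]
    simp

/-- `Δ` is the value of `t₀ q₀ + t₁ q₁` at the vector of Pfaffians. Under the base change `Q` this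
vector becomes `det Q` times the radical vector `w`, which gives the factor `δ²` with `δ = det Q`
and leaves the value at `w`. -/
theorem halfDisc_of_isKroneckerBasis [CharP k 2] {m : ℕ} {ι : Type*} [Fintype ι] [LinearOrder ι]
    (hι : Fintype.card ι = 2 * m + 1)
    (e : Module.Basis ι k E) {q₀ q₁ : QuadraticForm k E}
    {v : Module.Basis (Fin (m + 1) ⊕ Fin m) k E}
    (hv : IsKroneckerBasis q₀.polarBilin q₁.polarBilin v)
    (hf : ∀ i j, q₀.polarBilin (v (Sum.inr i)) (v (Sum.inr j)) = 0 ∧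
      q₁.polarBilin (v (Sum.inr i)) (v (Sum.inr j)) = 0) :
    ∃ δ : k, δ ≠ 0 ∧ halfDisc e q₀ q₁ = C (δ ^ 2) * ∑ i : Fin (m + 1),
      (X 0 * C (q₀ (v (Sum.inl i))) + X 1 * C (q₁ (v (Sum.inl i)))) *
        (X 0 ^ (m - i.1) * X 1 ^ i.1) ^ 2 := by
  let σ : Fin (m + 1) ⊕ Fin m ≃ ι := Fintype.equivOfCardEq (by
    simp only [Fintype.card_sum, Fintype.card_fin, hι]; ring)
  let u := v.reindex σ
  let Q : Matrix ι ι (MvPolynomial (Fin 2) k) := (u.toMatrix e).map C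
  let w : ι → MvPolynomial (Fin 2) k := kroneckerVec m (X 0) (X 1) ∘ σ.symm
  have hadju : (pencilMatrix q₀.polarBilin q₁.polarBilin u).adjugate = vecMulVec w w := by
    have h1 : pencilMatrix q₀.polarBilin q₁.polarBilin u =
        (pencilMatrix q₀.polarBilin q₁.polarBilin v).submatrix σ.symm σ.symm := by
      ext1 i j
      simp only [pencilMatrix, of_apply, submatrix_apply, u, Module.Basis.reindex_apply]
    rw [h1, adjugate_submatrix_equiv_self, pencilMatrix_isKroneckerBasis hv hf,
      adjugate_kronecker m _ _ (X_ne_zero 0)]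
    rfl
  have hdet : Q.det = C (u.toMatrix e).det := (RingHom.map_det C _).symm
  refine ⟨(u.toMatrix e).det, ?_, ?_⟩
  · have := u.toMatrix_mul_toMatrix_flip e
    exact left_ne_zero_of_mul_eq_one (by rw [← det_mul, this, det_one])
  · have hω : (fun i => omegaCoord (Matrix.of fun i j => if i = j then 0 else
        X 0 * C (coeffMatrix e q₀ i j) + X 1 * C (coeffMatrix e q₁ i j)) i) = Q.adjugate *ᵥ w := by
      funext i
      -- Square roots are unique here, so comparing with the diagonal of the adjugate determines
      -- each Pfaffian.
      apply CharTwo.sq_injective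
      simp only
      rw [omegaCoord_sq, pencilMatrix_basis_change _ _ u e, adjugate_mul_distrib,
        adjugate_mul_distrib, hadju, ← adjugate_transpose, vecMulVec_mul, mul_vecMulVec,
        vecMul_transpose, vecMulVec_apply, sq]
    have hQ : Q *ᵥ (Q.adjugate *ᵥ w) = Q.det • w := by
      rw [mulVec_mulVec, mul_adjugate, smul_mulVec, one_mulVec]
    have hq : ∀ (q : QuadraticForm k E) x, q x = q.toBilin e x x := fun q x => by
      conv_lhs => rw [← q.toQuadraticMap_toBilin e]
      rfl
    have hstart : halfDisc e q₀ q₁ = (Q.adjugate *ᵥ w) ⬝ᵥ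
        pencilMatrix (q₀.toBilin e) (q₁.toBilin e) e *ᵥ (Q.adjugate *ᵥ w) := by
      rw [← hω, ← sum_polar_eq_pencilMatrix]
      rfl
    rw [hstart, pencilMatrix_basis_change _ _ u e, ← mulVec_mulVec, ← mulVec_mulVec]
    change (Q.adjugate *ᵥ w) ⬝ᵥ Qᵀ *ᵥ (pencilMatrix _ _ u *ᵥ (Q *ᵥ (Q.adjugate *ᵥ w))) = _
    rw [dotProduct_mulVec, vecMul_transpose, hQ, mulVec_smul, smul_dotProduct, dotProduct_smul,
      dotProduct_pencilMatrix (hq q₀) (hq q₁) u w]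
    · rw [smul_smul, hdet, smul_eq_mul, ← map_mul, sq]
      congr 1
      rw [← Equiv.sum_comp σ, Fintype.sum_sum_type]
      simp [w, u, kroneckerVec]
    · intro i j hi hj
      obtain ⟨a, rfl⟩ := σ.surjective i
      obtain ⟨b, rfl⟩ := σ.surjective j
      rcases a with a | a
      · rcases b with b | b
        · simpa [u] using hv.1 a b
        · simp [w, kroneckerVec] at hj
      · simp [w, kroneckerVec] at hi

/-- The `i`-th summand involves only `t₀^(2m+1-2i) t₁^(2i)` and `t₀^(2m-2i) t₁^(2i+1)`, and these
monomials are distinct for all `i`. -/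
theorem halfDiscCoeff_of_isKroneckerBasis [CharP k 2] {m : ℕ}
    (e : Module.Basis (Fin (2 * m + 1)) k E) {q₀ q₁ : QuadraticForm k E}
    {v : Module.Basis (Fin (m + 1) ⊕ Fin m) k E}
    (hv : IsKroneckerBasis q₀.polarBilin q₁.polarBilin v)
    (hf : ∀ i j, q₀.polarBilin (v (Sum.inr i)) (v (Sum.inr j)) = 0 ∧
      q₁.polarBilin (v (Sum.inr i)) (v (Sum.inr j)) = 0) :
    ∃ δ : k, δ ≠ 0 ∧ ∀ i : Fin (m + 1),
      halfDiscCoeff e q₀ q₁ ⟨2 * i.1, by omega⟩ = δ ^ 2 * q₀ (v (Sum.inl i)) ∧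
      halfDiscCoeff e q₀ q₁ ⟨2 * i.1 + 1, by omega⟩ = δ ^ 2 * q₁ (v (Sum.inl i)) := by
  obtain ⟨δ, hδ, h⟩ := halfDisc_of_isKroneckerBasis (by simp) e hv hf
  refine ⟨δ, hδ, ?_⟩
  have hterm : ∀ i : Fin (m + 1), (X 0 * C (q₀ (v (Sum.inl i))) + X 1 * C (q₁ (v (Sum.inl i)))) *
        (X 0 ^ (m - i.1) * X 1 ^ i.1) ^ 2 =
      monomial (Finsupp.single (0 : Fin 2) (2 * m + 1 - 2 * i.1) + Finsupp.single 1 (2 * i.1))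
        (q₀ (v (Sum.inl i))) +
      monomial (Finsupp.single (0 : Fin 2) (2 * m - 2 * i.1) + Finsupp.single 1 (2 * i.1 + 1))
        (q₁ (v (Sum.inl i))) := by
    intro i
    have e1 : 2 * m + 1 - 2 * i.1 = 2 * (m - i.1) + 1 := by omega
    have e2 : 2 * m - 2 * i.1 = 2 * (m - i.1) := by omega
    rw [e1, e2]
    simp only [monomial_eq, Finsupp.prod_fintype, pow_zero, implies_true, Fin.prod_univ_two,
      Finsupp.add_apply, Finsupp.single_apply]
    simp
    ring
  have hne : ∀ a b c d : ℕ, b ≠ d → (Finsupp.single (0 : Fin 2) a + Finsupp.single 1 b) ≠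
      Finsupp.single 0 c + Finsupp.single 1 d := by
    intro a b c d hbd heq
    apply hbd
    simpa using DFunLike.congr_fun heq 1
  intro i
  simp only [halfDiscCoeff, h, coeff_C_mul, hterm, coeff_sum, coeff_add, coeff_monomial]
  constructor
  · rw [Finset.sum_eq_single i]
    · rw [if_pos rfl, if_neg (hne _ _ _ _ (by omega)), add_zero]
    · intro j _ hj
      have : j.1 ≠ i.1 := fun h => hj (Fin.ext h)
      rw [if_neg (hne _ _ _ _ (by omega)), if_neg (hne _ _ _ _ (by omega)), add_zero]
    · simp
  · rw [Finset.sum_eq_single i]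
    · rw [if_neg (hne _ _ _ _ (by omega)), if_pos (by congr 2; omega), zero_add]
    · intro j _ hj
      have : j.1 ≠ i.1 := fun h => hj (Fin.ext h)
      rw [if_neg (hne _ _ _ _ (by omega)), if_neg (hne _ _ _ _ (by omega)), add_zero]
    · simp

end HalfDisc

/-! ### Artin–Schreier equations for semilinear maps -/

section Semilinear

open Polynomial

/-- The solution is sought in the span of the iterates `F^n r` up to the first found relation `g
(d+1) = ∑ c_i g_i`. Comparing coefficients expresses each coordinate through the last one, `z`, and
leaves one polynomial equation for `z`. -/
theorem exists_add_semilinear_eq {K V : Type*} [Field K] [IsAlgClosed K] [CharP K 2]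
    [AddCommGroup V] [Module K V] [FiniteDimensional K V] (F : V →+ V)
    (hF : ∀ (c : K) v, F (c • v) = c ^ 2 • F v) (r : V) : ∃ v, v + F v = r := by
  let g : ℕ → V := fun n => F^[n] r
  have hg : ∀ n, g (n + 1) = F (g n) := fun n => Function.iterate_succ_apply' F n r
  let S : ℕ →o Submodule K V :=
    ⟨fun d => Submodule.span K (Set.range fun i : Fin d => g i), fun a b hab =>
      Submodule.span_mono (by rintro _ ⟨i, rfl⟩; exact ⟨Fin.castLE hab i, rfl⟩)⟩
  obtain ⟨d, hd⟩ := monotone_stabilizes_iff_noetherian.2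
    (inferInstance : IsNoetherian K V) S
  have hmem : g d ∈ S d := by
    rw [hd (d + 1) (Nat.le_succ d)]
    exact Submodule.subset_span ⟨Fin.last d, rfl⟩
  obtain ⟨c', hc'⟩ := (Submodule.mem_span_range_iff_exists_fun K).1 hmem
  rcases d with _ | d
  · refine ⟨0, ?_⟩
    have : r = 0 := by simpa [g] using hc'.symm
    simp [this]
  let c : ℕ → K := fun i => if h : i < d + 1 then c' ⟨i, h⟩ else 0
  have hc : g (d + 1) = ∑ i ∈ Finset.range (d + 1), c i • g i := by
    rw [← hc', Finset.sum_range]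
    exact Finset.sum_congr rfl fun i _ => by simp only [c, dif_pos i.2]
  -- `P i` is the `i`-th coordinate as a polynomial in `z`; consistency requires `P d = z`. All `P
  -- i` have derivative zero, so `P d - X` has derivative `-1` and cannot be constant.
  let P : ℕ → K[X] := fun n => Nat.rec (1 - C (c 0) * X ^ 2)
    (fun i p => - p ^ 2 - C (c (i + 1)) * X ^ 2) n
  have hP0 : P 0 = 1 - C (c 0) * X ^ 2 := rfl
  have hP1 : ∀ i, P (i + 1) = - P i ^ 2 - C (c (i + 1)) * X ^ 2 := fun i => rfl
  have hder : ∀ i, derivative (P i) = 0 := by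
    intro i
    cases i with
    | zero => simp [hP0, derivative_pow, CharTwo.two_eq_zero]
    | succ i => simp [hP1, derivative_pow, CharTwo.two_eq_zero]
  obtain ⟨z, hz⟩ := IsAlgClosed.exists_root (P d - X) (by
    intro h
    have h1 := congrArg derivative (eq_C_of_degree_eq_zero h)
    rw [derivative_sub, hder, derivative_X, derivative_C, zero_sub, neg_eq_zero] at h1
    exact one_ne_zero h1)
  have hzd : (P d).eval z = z := by
    have : (P d - X).eval z = 0 := hz
    rw [eval_sub, eval_X] at this
    exact sub_eq_zero.1 this
  let x : ℕ → K := fun i => (P i).eval z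
  have hx0 : x 0 + z ^ 2 * c 0 = 1 := by simp [x, hP0]; ring
  have hx1 : ∀ i, x (i + 1) + x i ^ 2 + z ^ 2 * c (i + 1) = 0 := fun i => by
    simp [x, hP1]; ring
  refine ⟨∑ i ∈ Finset.range (d + 1), x i • g i, ?_⟩
  have hFv : F (∑ i ∈ Finset.range (d + 1), x i • g i) =
      ∑ i ∈ Finset.range d, x i ^ 2 • g (i + 1) + z ^ 2 • ∑ i ∈ Finset.range (d + 1), c i • g i := by
    rw [map_sum, Finset.sum_range_succ, ← hc, hF, hg]
    congr 1
    · exact Finset.sum_congr rfl fun i _ => by rw [hF, hg]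
    · rw [show x d = z from hzd]
  rw [hFv, Finset.sum_range_succ', Finset.sum_range_succ' (fun i => c i • g i), smul_add,
    Finset.smul_sum]
  calc _ = (x 0 + z ^ 2 * c 0) • g 0 + ∑ i ∈ Finset.range d,
        (x (i + 1) + x i ^ 2 + z ^ 2 * c (i + 1)) • g (i + 1) := by
        simp only [add_smul, Finset.sum_add_distrib, mul_smul]; abel
    _ = r := by simp [hx0, hx1, g]

end Semilinear

/-! ### Kernels of the pencil and Kronecker bases over an algebraically closed field -/

section Quadratic

variable {K E : Type*} [Field K] [AddCommGroup E] [Module K E]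

theorem map_sum_smul_of_polarBilin_eq_zero {ι : Type*} (q : QuadraticForm K E) (s : Finset ι)
    (g : ι → E) (h : ∀ i j, q.polarBilin (g i) (g j) = 0) (x : ι → K) :
    q (∑ i ∈ s, x i • g i) = ∑ i ∈ s, x i ^ 2 * q (g i) := by
  classical
  induction s using Finset.induction_on with
  | empty => simp
  | insert a s ha ih =>
    have hp : QuadraticMap.polar q (x a • g a) (∑ i ∈ s, x i • g i) = 0 := by
      rw [← QuadraticMap.polarBilin_apply_apply, map_sum]
      exact Finset.sum_eq_zero fun i _ => by simp only [map_smul, LinearMap.smul_apply, h, smul_zero]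
    rw [Finset.sum_insert ha, Finset.sum_insert ha, QuadraticMap.map_add q, hp, ih,
      QuadraticMap.map_smul, smul_eq_mul, add_zero, sq]

theorem exists_ne_zero_map_eq_zero [IsAlgClosed K] (q : QuadraticForm K E) (M : Submodule K E)
    (hM : 2 ≤ Module.finrank K M) : ∃ v ∈ M, v ≠ 0 ∧ q v = 0 := by
  obtain ⟨f, hf⟩ := exists_linearIndependent_of_le_finrank hM
  by_cases h0 : q (f 0 : E) = 0
  · exact ⟨f 0, (f 0).2, fun h => hf.ne_zero 0 (Subtype.ext h), h0⟩
  obtain ⟨z, hz⟩ := IsAlgClosed.exists_root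
    (Polynomial.C (q (f 0 : E)) * Polynomial.X ^ 2 +
      Polynomial.C (QuadraticMap.polar q (f 0 : E) (f 1)) * Polynomial.X +
      Polynomial.C (q (f 1 : E))) (by rw [Polynomial.degree_quadratic h0]; decide)
  refine ⟨z • f 0 + f 1, add_mem (M.smul_mem _ (f 0).2) (f 1).2, fun h => ?_, ?_⟩
  · have h' : z • f 0 + (1 : K) • f 1 = 0 := by rw [one_smul]; exact Subtype.ext h
    have hf' : LinearIndependent K ![f 0, f 1] := by
      convert hf using 1
      funext i
      fin_cases i <;> rfl
    exact one_ne_zero (LinearIndependent.pair_iff.1 hf' z 1 h').2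
  · have hz' : q (f 0 : E) * z ^ 2 + QuadraticMap.polar q (f 0 : E) (f 1) * z + q (f 1 : E) = 0 := by
      simpa [Polynomial.IsRoot] using hz
    rw [QuadraticMap.map_add q, QuadraticMap.map_smul, QuadraticMap.polar_smul_left]
    simp only [smul_eq_mul]
    linear_combination hz'

theorem odd_finrank_ker_of_isAlt [CharP K 2] [FiniteDimensional K E] {b : E →ₗ[K] E →ₗ[K] K}
    (hb : b.IsAlt) (hE : Odd (Module.finrank K E)) : Odd (Module.finrank K (LinearMap.ker b)) := by
  obtain ⟨C, hC⟩ := Submodule.exists_isCompl (LinearMap.ker b)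
  have hr := Submodule.finrank_add_eq_of_isCompl hC
  by_contra hodd
  have hCodd : Odd (Module.finrank K C) := by
    rw [Nat.not_odd_iff_even] at hodd
    rw [← hr] at hE
    exact (Nat.odd_add'.1 hE).2 hodd
  obtain ⟨v, hvC, hv0, hv⟩ := exists_radical_of_odd hb C hCodd
  refine hv0 (Submodule.disjoint_def.1 hC.disjoint v (LinearMap.mem_ker.2 (LinearMap.ext fun u => ?_))
    hvC)
  have hu : u ∈ LinearMap.ker b ⊔ C := by rw [hC.sup_eq_top]; trivial
  obtain ⟨w, hw, c, hc, rfl⟩ := Submodule.mem_sup.1 hu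
  rw [map_add, hv c hc, add_zero, symm_of_isAlt hb, LinearMap.mem_ker.1 hw]
  rfl

variable [IsAlgClosed K] [CharP K 2] [FiniteDimensional K E]

/-- On `N` the form is additive, so its square root is a linear functional, whose kernel has
codimension at most one. -/
theorem two_le_finrank_of_additive (q : QuadraticForm K E) (N : Submodule K E)
    (hN : 3 ≤ Module.finrank K N) (hq : ∀ v ∈ N, ∀ w ∈ N, q.polarBilin v w = 0) :
    ∃ M ≤ N, 2 ≤ Module.finrank K M ∧ ∀ v ∈ M, q v = 0 := by
  have : Fact (Nat.Prime 2) := ⟨Nat.prime_two⟩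
  let φ : N →ₗ[K] K :=
    { toFun := fun v => (frobeniusEquiv K 2).symm (q v)
      map_add' := fun v w => by
        have := hq v v.2 w w.2
        rw [QuadraticMap.polarBilin_apply_apply] at this
        rw [Submodule.coe_add, QuadraticMap.map_add q, this, add_zero, map_add]
      map_smul' := fun c v => by
        rw [Submodule.coe_smul, QuadraticMap.map_smul, smul_eq_mul, map_mul, ← sq,
          frobeniusEquiv_symm_pow]
        rfl }
  refine ⟨(LinearMap.ker φ).map N.subtype, Submodule.map_subtype_le _ _, ?_, ?_⟩
  · rw [Submodule.finrank_map_subtype_eq]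
    have h1 := LinearMap.finrank_range_add_finrank_ker φ
    have h2 : Module.finrank K (LinearMap.range φ) ≤ 1 := by
      simpa using Submodule.finrank_le (LinearMap.range φ)
    omega
  · rintro _ ⟨v, hv, rfl⟩
    have : (frobeniusEquiv K 2).symm (q v) = 0 := hv
    simpa using this

/-- The kernel has odd dimension. If it were at least 3, the member `s q₀ + t q₁` would vanish on a
plane in the kernel. A zero on it of a suitable `q_i` is then a point of `X` where the differentials
are dependent. -/
theorem finrank_ker_le_one {q₀ q₁ : QuadraticForm K E} (hE : Odd (Module.finrank K E))
    (hreg : ∀ v, v ≠ 0 → q₀ v = 0 → q₁ v = 0 → ∀ s t : K,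
      (∀ u, s * q₀.polarBilin v u + t * q₁.polarBilin v u = 0) → s = 0 ∧ t = 0)
    {s t : K} (hst : s ≠ 0 ∨ t ≠ 0) :
    Module.finrank K (LinearMap.ker (s • q₀.polarBilin + t • q₁.polarBilin)) ≤ 1 := by
  set N : Submodule K E := LinearMap.ker (s • q₀.polarBilin + t • q₁.polarBilin) with hN
  by_contra hlt
  have hlt' : 1 < Module.finrank K N := not_le.1 hlt
  have halt : (s • q₀.polarBilin + t • q₁.polarBilin).IsAlt := fun v => by
    simp only [LinearMap.add_apply, LinearMap.smul_apply, polarBilin_isAlt q₀ v,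
      polarBilin_isAlt q₁ v, smul_zero, add_zero]
  have hodd : Odd (Module.finrank K N) := odd_finrank_ker_of_isAlt halt hE
  have h3 : 3 ≤ Module.finrank K N := by
    obtain ⟨a, ha⟩ := hodd
    omega
  have hpol : ∀ v ∈ N, ∀ u, s * q₀.polarBilin v u + t * q₁.polarBilin v u = 0 := by
    intro v hv u
    simpa only [LinearMap.add_apply, LinearMap.smul_apply, smul_eq_mul, LinearMap.zero_apply]
      using LinearMap.congr_fun (LinearMap.mem_ker.1 hv) u
  obtain ⟨M, hMN, hM2, hM⟩ := two_le_finrank_of_additive (s • q₀ + t • q₁) N h3 (by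
    intro v hv w _
    have := hpol v hv w
    rw [QuadraticMap.polarBilin_apply_apply, QuadraticMap.polarBilin_apply_apply] at this
    rw [QuadraticMap.polarBilin_apply_apply, FunLike.coe_add, QuadraticMap.polar_add,
      FunLike.coe_smul, FunLike.coe_smul, QuadraticMap.polar_smul,
      QuadraticMap.polar_smul, smul_eq_mul, smul_eq_mul, this])
  have hM' : ∀ v ∈ M, s * q₀ v + t * q₁ v = 0 := fun v hv => by simpa using hM v hv
  by_cases hs : s = 0
  · have ht : t ≠ 0 := hst.resolve_left fun h => h hs
    obtain ⟨v, hvM, hv0, hv⟩ := exists_ne_zero_map_eq_zero q₀ M hM2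
    have hv1 : q₁ v = 0 := by
      have := hM' v hvM
      rw [hv, mul_zero, zero_add] at this
      exact (mul_eq_zero.1 this).resolve_left ht
    exact ht (hreg v hv0 hv hv1 s t (hpol v (hMN hvM))).2
  · obtain ⟨v, hvM, hv0, hv⟩ := exists_ne_zero_map_eq_zero q₁ M hM2
    have hv1 : q₀ v = 0 := by
      have := hM' v hvM
      rw [hv, mul_zero, add_zero] at this
      exact (mul_eq_zero.1 this).resolve_left hs
    exact hs (hreg v hv0 hv1 hv s t (hpol v (hMN hvM))).1

/-- For every nonzero member of the pencil, the map from `W` to the dual of `C` has kernel of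
dimension at most one, hence is surjective. So the transposed map from `C` is injective, which rules
out eigenvectors of the pencil on `C`. -/
theorem exists_isKroneckerBasis_of_isAlgClosed {q₀ q₁ : QuadraticForm K E} {m : ℕ}
    (hE : Module.finrank K E = 2 * m + 1)
    (hreg : ∀ v, v ≠ 0 → q₀ v = 0 → q₁ v = 0 → ∀ s t : K,
      (∀ u, s * q₀.polarBilin v u + t * q₁.polarBilin v u = 0) → s = 0 ∧ t = 0) :
    ∃ v : Module.Basis (Fin (m + 1) ⊕ Fin m) K E,
      IsKroneckerBasis q₀.polarBilin q₁.polarBilin v := by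
  obtain ⟨W, -, hWr, hW⟩ := exists_isotropic (polarBilin_isAlt q₀) (polarBilin_isAlt q₁) m ⊤
    (by rw [finrank_top, hE])
  obtain ⟨C, hC⟩ := Submodule.exists_isCompl W
  have hCr : Module.finrank K C = m := by
    have := Submodule.finrank_add_eq_of_isCompl hC
    omega
  have hnd : ∀ s t : K, (s ≠ 0 ∨ t ≠ 0) → ∀ v ∈ C,
      (∀ w ∈ W, s * q₀.polarBilin v w + t * q₁.polarBilin v w = 0) → v = 0 := by
    intro s t hst v hv h
    let β : E →ₗ[K] E →ₗ[K] K := s • q₀.polarBilin + t • q₁.polarBilin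
    have hβ : ∀ x y, β x y = s * q₀.polarBilin x y + t * q₁.polarBilin x y := fun x y => rfl
    let ψ : W →ₗ[K] Module.Dual K C := β.compl₁₂ W.subtype C.subtype
    have hψ : ∀ (w : W) (c : C), ψ w c = β w c := fun _ _ => rfl
    have hker : (LinearMap.ker ψ).map W.subtype ≤ LinearMap.ker β := by
      rintro _ ⟨w, hw, rfl⟩
      refine LinearMap.mem_ker.2 (LinearMap.ext fun u => ?_)
      have hu : u ∈ W ⊔ C := by rw [hC.sup_eq_top]; trivial
      obtain ⟨x, hx, c, hc, rfl⟩ := Submodule.mem_sup.1 hu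
      have h1 : ψ w ⟨c, hc⟩ = 0 := by rw [LinearMap.mem_ker.1 hw]; rfl
      rw [hψ] at h1
      have h2 : β w x = 0 := by
        rw [hβ, (hW w w.2 x hx).1, (hW w w.2 x hx).2, mul_zero, mul_zero, add_zero]
      rw [map_add, Submodule.subtype_apply, h1, h2, add_zero, LinearMap.zero_apply]
    have hker1 : Module.finrank K (LinearMap.ker ψ) ≤ 1 := by
      rw [← Submodule.finrank_map_subtype_eq W (LinearMap.ker ψ)]
      exact (Submodule.finrank_mono hker).trans
        (finrank_ker_le_one (by rw [hE]; exact ⟨m, rfl⟩) hreg hst)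
    have hsurj : LinearMap.range ψ = ⊤ := by
      apply Submodule.eq_top_of_finrank_eq
      apply le_antisymm (Submodule.finrank_le _)
      have := LinearMap.finrank_range_add_finrank_ker ψ
      rw [Subspace.dual_finrank_eq]
      omega
    have hv0 : (⟨v, hv⟩ : C) = 0 := by
      rw [← Module.forall_dual_apply_eq_zero_iff K]
      intro φ
      obtain ⟨w, rfl⟩ := LinearMap.range_eq_top.1 hsurj φ
      rw [hψ, hβ, symm_of_isAlt (polarBilin_isAlt q₀), symm_of_isAlt (polarBilin_isAlt q₁)]
      exact h w w.2
    exact congrArg Subtype.val hv0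
  obtain ⟨v, hv, -⟩ := exists_isKroneckerBasis (b₀ := q₀.polarBilin) (b₁ := q₁.polarBilin)
    hC hWr hCr hW
    (fun v hv h => hnd 0 1 (Or.inr one_ne_zero) v hv fun w hw => by
      rw [h w hw, zero_mul, mul_zero, add_zero])
    (by
      intro S hSC hS h
      have : Nontrivial S := Submodule.nontrivial_iff_ne_bot.2 hS
      obtain ⟨c, v, hv0, hv⟩ := exists_eigenvector
        (q₀.polarBilin.compl₁₂ S.subtype W.subtype) (q₁.polarBilin.compl₁₂ S.subtype W.subtype)
        (by
          rw [← LinearMap.ker_eq_bot, LinearMap.ker_eq_bot']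
          intro x hx
          refine Subtype.ext (hnd 0 1 (Or.inr one_ne_zero) x (hSC x.2) fun w hw => ?_)
          rw [zero_mul, zero_add, one_mul]
          exact LinearMap.congr_fun hx ⟨w, hw⟩)
        (fun x => by
          obtain ⟨u, hu, hxu⟩ := h x x.2
          exact ⟨⟨u, hu⟩, LinearMap.ext fun w => hxu w w.2⟩)
      refine hv0 (Subtype.ext (hnd 1 (-c) (Or.inl one_ne_zero) v (hSC v.2) fun w hw => ?_))
      have := LinearMap.congr_fun hv ⟨w, hw⟩
      have h' : q₀.polarBilin v w = c * q₁.polarBilin v w := this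
      rw [h']; ring)
  exact ⟨v, hv⟩

end Quadratic

/-! ### The linear equations for the polar forms -/

section Shear

/-- A solution `c` of the equations `c i j + c j i = Q i j` and
`c (i + 1) j + c (j + 1) i = P i j` for `i ≠ j`, in characteristic `2`. -/
def skewSolution {K : Type*} [Zero K] [Add K] (P Q : ℕ → ℕ → K) (i l : ℕ) : K :=
  if i < l then Q i l + skewSolution P Q l i
  else if l + 2 ≤ i then P (i - 1) l + skewSolution P Q (l + 1) (i - 1) else 0
-- Both recursive calls keep `i + l` fixed and move along the antidiagonal towards its middle, where
-- the value `0` is chosen freely.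
termination_by if i < l then 2 * (l - i) + 1 else 2 * (i - l)
decreasing_by
  · simp only [*, if_true]; split_ifs <;> omega
  · split_ifs <;> omega

variable {K : Type*} [CommRing K] [CharP K 2] {P Q : ℕ → ℕ → K}

theorem skewSolution_add (hQ : ∀ i j, Q i j = Q j i) (hQ0 : ∀ i, Q i i = 0) (i j : ℕ) :
    Q i j + skewSolution P Q i j + skewSolution P Q j i = 0 := by
  rcases lt_trichotomy i j with h | rfl | h
  · rw [skewSolution.eq_1 P Q i j, if_pos h, ← add_assoc, CharTwo.add_self_eq_zero, zero_add,
      CharTwo.add_self_eq_zero]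
  · rw [hQ0, zero_add, CharTwo.add_self_eq_zero]
  · rw [skewSolution.eq_1 P Q j i, if_pos h, hQ j i]
    linear_combination CharTwo.add_self_eq_zero (Q i j) + CharTwo.add_self_eq_zero (skewSolution P Q i j)

theorem skewSolution_succ_add (hP : ∀ i j, P i j = P j i) (hP0 : ∀ i, P i i = 0) (i j : ℕ) :
    P i j + skewSolution P Q (i + 1) j + skewSolution P Q (j + 1) i = 0 := by
  have key : ∀ i j, j < i → P i j + skewSolution P Q (i + 1) j + skewSolution P Q (j + 1) i = 0 := by
    intro i j h
    rw [skewSolution.eq_1 P Q (i + 1) j, if_neg (by omega), if_pos (by omega), Nat.add_sub_cancel]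
    linear_combination CharTwo.add_self_eq_zero (P i j) +
      CharTwo.add_self_eq_zero (skewSolution P Q (j + 1) i)
  rcases lt_trichotomy i j with h | rfl | h
  · rw [hP]; linear_combination key j i h
  · rw [hP0, zero_add, CharTwo.add_self_eq_zero]
  · exact key i j h

end Shear

/-! ### Subspaces of X of dimension m over an algebraically closed field -/

section Singular

variable {K E : Type*} [Field K] [AddCommGroup E] [Module K E]

theorem map_eq_zero_of_mem_span {q : QuadraticForm K E} {S : Set E} (hq : ∀ v ∈ S, q v = 0)
    (hp : ∀ v ∈ S, ∀ w ∈ S, q.polarBilin v w = 0) {v : E} (hv : v ∈ Submodule.span K S) :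
    q v = 0 := by
  have h1 : ∀ s ∈ S, ∀ w ∈ Submodule.span K S, q.polarBilin s w = 0 := fun s hs w hw =>
    (Submodule.span_le.2 fun x hx => hp s hs x hx :
      Submodule.span K S ≤ LinearMap.ker (q.polarBilin s)) hw
  induction hv using Submodule.span_induction with
  | mem x hx => exact hq x hx
  | zero => simp
  | add x y hx hy hqx hqy =>
    have h2 : x ∈ LinearMap.ker (q.polarBilin.flip y) :=
      (Submodule.span_le.2 fun s hs => h1 s hs y hy :
        Submodule.span K S ≤ LinearMap.ker (q.polarBilin.flip y)) hx
    have h3 : QuadraticMap.polar q x y = 0 := h2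
    rw [QuadraticMap.map_add q, hqx, hqy, h3, add_zero, add_zero]
  | smul c x _ hqx => rw [QuadraticMap.map_smul, hqx, smul_zero]

variable {m : ℕ} {q : QuadraticForm K E} {e : Fin (m + 1) → E} {f : Fin m → E}
  {σ : Fin m → Fin (m + 1)}

theorem map_shear (hee : ∀ i j, q.polarBilin (e i) (e j) = 0)
    (hfe : ∀ i j, q.polarBilin (f i) (e j) = if j = σ i then 1 else 0)
    (a : Fin (m + 1) → Fin m → K) (j : Fin m) :
    q (f j + ∑ i, a i j • e i) = q (f j) + ∑ i, a i j ^ 2 * q (e i) + a (σ j) j := by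
  have hp : QuadraticMap.polar q (f j) (∑ i, a i j • e i) = a (σ j) j := by
    rw [← QuadraticMap.polarBilin_apply_apply]
    simp only [map_sum, map_smul, hfe, smul_eq_mul, mul_ite, mul_one, mul_zero,
      Finset.sum_ite_eq', Finset.mem_univ, if_true]
  rw [QuadraticMap.map_add q, hp, map_sum_smul_of_polarBilin_eq_zero q _ _ hee]

variable [CharP K 2]

theorem polarBilin_shear (hee : ∀ i j, q.polarBilin (e i) (e j) = 0)
    (hfe : ∀ i j, q.polarBilin (f i) (e j) = if j = σ i then 1 else 0)
    (a : Fin (m + 1) → Fin m → K) (j l : Fin m) :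
    q.polarBilin (f j + ∑ i, a i j • e i) (f l + ∑ i, a i l • e i) =
      q.polarBilin (f j) (f l) + a (σ j) l + a (σ l) j := by
  have hef : ∀ i j, q.polarBilin (e j) (f i) = if j = σ i then 1 else 0 := fun i j => by
    rw [symm_of_isAlt (polarBilin_isAlt q), hfe]
  simp only [map_add, LinearMap.add_apply, map_sum, LinearMap.sum_apply, map_smul,
    LinearMap.smul_apply, hee, hfe, hef, smul_eq_mul, mul_ite, mul_one, mul_zero,
    Finset.sum_ite_eq', Finset.mem_univ, if_true, Finset.sum_const_zero, add_zero]
  ring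

variable [FiniteDimensional K E] {q₀ q₁ : QuadraticForm K E}

/-- The system of Artin–Schreier equations `s_l + ∑ a_{2p-l+1} s_p² = r_l`. -/
theorem exists_hankel_solution [IsAlgClosed K] (α₀ α₁ : Fin (m + 1) → K) (r₀ r₁ : Fin m → K) :
    ∃ s : ℕ → K, ∀ j : Fin m, s (2 * j.1 + 1) + ∑ i : Fin (m + 1), s (i.1 + j.1) ^ 2 * α₀ i = r₀ j ∧
      s (2 * j.1) + ∑ i : Fin (m + 1), s (i.1 + j.1) ^ 2 * α₁ i = r₁ j := by
  -- The default value is never reached: `i ≤ m` and `j ≤ m - 1` give `i + j < 2m`. Thus there are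
  -- as many unknowns as equations.
  let ext : (Fin (2 * m) → K) → ℕ → K := fun s n => if h : n < 2 * m then s ⟨n, h⟩ else 0
  have hadd : ∀ s t n, ext (s + t) n = ext s n + ext t n := by
    intro s t n; simp only [ext]; split_ifs <;> simp
  have hsmul : ∀ (c : K) s n, ext (c • s) n = c * ext s n := by
    intro c s n; simp only [ext]; split_ifs <;> simp
  let F : (Fin (2 * m) → K) →+ (Fin (2 * m) → K) := AddMonoidHom.mk'
    (fun s l => ∑ i : Fin (m + 1), ext s (i.1 + l.1 / 2) ^ 2 * (if Even l.1 then α₁ i else α₀ i))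
    (fun s t => by
      funext l
      simp only [hadd, CharTwo.add_sq, add_mul, Finset.sum_add_distrib, Pi.add_apply])
  have hFapp : ∀ s l, F s l = ∑ i : Fin (m + 1), ext s (i.1 + l.1 / 2) ^ 2 *
      (if Even l.1 then α₁ i else α₀ i) := fun _ _ => rfl
  have hF : ∀ (c : K) s, F (c • s) = c ^ 2 • F s := by
    intro c s
    funext l
    simp only [hFapp, hsmul, mul_pow, Pi.smul_apply, smul_eq_mul, Finset.mul_sum, mul_assoc]
  obtain ⟨s, hs⟩ := exists_add_semilinear_eq F hF
    (fun l => if Even l.1 then r₁ ⟨l.1 / 2, by omega⟩ else r₀ ⟨l.1 / 2, by omega⟩)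
  refine ⟨ext s, fun j => ⟨?_, ?_⟩⟩
  · have h := congrFun hs ⟨2 * j.1 + 1, by omega⟩
    have h1 : ¬ Even (2 * j.1 + 1) := by simp
    have h2 : (2 * j.1 + 1) / 2 = j.1 := by omega
    simp only [Pi.add_apply, hFapp, h1, if_false, h2] at h
    rw [← h]
    simp only [ext, dif_pos (show 2 * j.1 + 1 < 2 * m by omega)]
  · have h := congrFun hs ⟨2 * j.1, by omega⟩
    have h1 : Even (2 * j.1) := by simp
    have h2 : 2 * j.1 / 2 = j.1 := by omega
    simp only [Pi.add_apply, hFapp, h1, if_true, h2] at h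
    rw [← h]
    simp only [ext, dif_pos (show 2 * j.1 < 2 * m by omega)]

/-- The `f_j` of a Kronecker basis are sheared along the `e_i`. The particular solution `c` kills
the polar forms among the new vectors, and the Hankel part `s` is left free to kill the values of
`q₀` and `q₁`. -/
theorem exists_singular_subspace [IsAlgClosed K] (hE : Module.finrank K E = 2 * m + 1)
    (hreg : ∀ v, v ≠ 0 → q₀ v = 0 → q₁ v = 0 → ∀ s t : K,
      (∀ u, s * q₀.polarBilin v u + t * q₁.polarBilin v u = 0) → s = 0 ∧ t = 0) :
    ∃ L : Submodule K E, Module.finrank K L = m ∧ ∀ v ∈ L, q₀ v = 0 ∧ q₁ v = 0 := by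
  obtain ⟨v, hee, hfe₀, hfe₁⟩ := exists_isKroneckerBasis_of_isAlgClosed hE hreg
  let e : Fin (m + 1) → E := fun i => v (Sum.inl i)
  let f : Fin m → E := fun i => v (Sum.inr i)
  let G : QuadraticForm K E → ℕ → ℕ → K := fun q i j =>
    if h : i < m ∧ j < m then q.polarBilin (f ⟨i, h.1⟩) (f ⟨j, h.2⟩) else 0
  have hG : ∀ q (i j : Fin m), G q i j = q.polarBilin (f i) (f j) := fun q i j => by
    simp only [G, dif_pos (And.intro i.2 j.2)]
  have hGs : ∀ q i j, G q i j = G q j i := by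
    intro q i j
    by_cases h : i < m ∧ j < m
    · simp only [G, dif_pos h, dif_pos h.symm]
      exact symm_of_isAlt (polarBilin_isAlt q) _ _
    · simp only [G, dif_neg h, dif_neg fun h' => h (And.symm h')]
  have hG0 : ∀ q i, G q i i = 0 := by
    intro q i
    by_cases h : i < m ∧ i < m
    · simp only [G, dif_pos h]; exact polarBilin_isAlt q _
    · simp only [G, dif_neg h]
  let c := skewSolution (G q₀) (G q₁)
  obtain ⟨s, hs⟩ := exists_hankel_solution (fun i => q₀ (e i)) (fun i => q₁ (e i))
    (fun j : Fin m => q₀ (f j) + ∑ i : Fin (m + 1), c i.1 j.1 ^ 2 * q₀ (e i) + c (j.1 + 1) j.1)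
    (fun j : Fin m => q₁ (f j) + ∑ i : Fin (m + 1), c i.1 j.1 ^ 2 * q₁ (e i) + c j.1 j.1)
  -- The Hankel part does not affect the polar conditions: it enters them as `s_{j+l+1}` or
  -- `s_{j+l}` twice.
  let a : Fin (m + 1) → Fin m → K := fun i j => c i.1 j.1 + s (i.1 + j.1)
  let g : Fin m → E := fun j => f j + ∑ i, a i j • e i
  have hsq : ∀ (q : QuadraticForm K E) j, ∑ i, a i j ^ 2 * q (e i) =
      ∑ i : Fin (m + 1), c i.1 j.1 ^ 2 * q (e i) +
        ∑ i : Fin (m + 1), s (i.1 + j.1) ^ 2 * q (e i) := by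
    intro q j
    rw [← Finset.sum_add_distrib]
    exact Finset.sum_congr rfl fun i _ => by simp only [a, CharTwo.add_sq, add_mul]
  have hq₀ : ∀ j, q₀ (g j) = 0 := by
    intro j
    have h := (hs j).1
    simp only [g]
    rw [map_shear (fun i j => (hee i j).1) hfe₀ a j, hsq]
    simp only [a, Fin.val_succ]
    rw [show j.1 + 1 + j.1 = 2 * j.1 + 1 by ring]
    linear_combination h + CharTwo.add_self_eq_zero (q₀ (f j) +
      ∑ i : Fin (m + 1), c i.1 j.1 ^ 2 * q₀ (e i) + c (j.1 + 1) j.1)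
  have hq₁ : ∀ j, q₁ (g j) = 0 := by
    intro j
    have h := (hs j).2
    simp only [g]
    rw [map_shear (fun i j => (hee i j).2) hfe₁ a j, hsq]
    simp only [a, Fin.val_castSucc]
    rw [show j.1 + j.1 = 2 * j.1 by ring]
    linear_combination h + CharTwo.add_self_eq_zero (q₁ (f j) +
      ∑ i : Fin (m + 1), c i.1 j.1 ^ 2 * q₁ (e i) + c j.1 j.1)
  have hp₀ : ∀ j l, q₀.polarBilin (g j) (g l) = 0 := by
    intro j l
    simp only [g]
    rw [polarBilin_shear (fun i j => (hee i j).1) hfe₀ a j l, ← hG]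
    simp only [a, Fin.val_succ]
    rw [show l.1 + 1 + j.1 = j.1 + 1 + l.1 by ring]
    linear_combination skewSolution_succ_add (Q := G q₁) (hGs q₀) (hG0 q₀) j.1 l.1 +
      CharTwo.add_self_eq_zero (s (j.1 + 1 + l.1))
  have hp₁ : ∀ j l, q₁.polarBilin (g j) (g l) = 0 := by
    intro j l
    simp only [g]
    rw [polarBilin_shear (fun i j => (hee i j).2) hfe₁ a j l, ← hG]
    simp only [a, Fin.val_castSucc]
    rw [show l.1 + j.1 = j.1 + l.1 by ring]
    linear_combination skewSolution_add (P := G q₀) (hGs q₁) (hG0 q₁) j.1 l.1 +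
      CharTwo.add_self_eq_zero (s (j.1 + l.1))
  have hli : LinearIndependent K g := by
    rw [Fintype.linearIndependent_iff]
    intro x hx j
    have := congrArg (v.coord (Sum.inr j)) hx
    simpa [g, e, f, Finsupp.single_apply] using this
  refine ⟨Submodule.span K (Set.range g), ?_, fun w hw => ⟨?_, ?_⟩⟩
  · rw [finrank_span_eq_card hli, Fintype.card_fin]
  · refine map_eq_zero_of_mem_span ?_ ?_ hw
    · rintro _ ⟨j, rfl⟩; exact hq₀ j
    · rintro _ ⟨j, rfl⟩ _ ⟨l, rfl⟩; exact hp₀ j l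
  · refine map_eq_zero_of_mem_span ?_ ?_ hw
    · rintro _ ⟨j, rfl⟩; exact hq₁ j
    · rintro _ ⟨j, rfl⟩ _ ⟨l, rfl⟩; exact hp₁ j l

end Singular

/-! ### From generators to normal forms and back -/

section NormalForm

variable {k E : Type*} [Field k] [AddCommGroup E] [Module k E]

theorem map_eq_of_adapted_basis {m : ℕ} {q : QuadraticForm k E}
    {σ : Fin m → Fin (m + 1)} (v : Module.Basis (Fin (m + 1) ⊕ Fin m) k E)
    (hee : ∀ i j, q.polarBilin (v (Sum.inl i)) (v (Sum.inl j)) = 0)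
    (hff : ∀ i j, q.polarBilin (v (Sum.inr i)) (v (Sum.inr j)) = 0)
    (hfe : ∀ i j, q.polarBilin (v (Sum.inr i)) (v (Sum.inl j)) = if j = σ i then 1 else 0)
    (hf : ∀ i, q (v (Sum.inr i)) = 0) (u : E) :
    q u = ∑ i, q (v (Sum.inl i)) * v.coord (Sum.inl i) u ^ 2 +
      ∑ i, v.coord (Sum.inl (σ i)) u * v.coord (Sum.inr i) u := by
  have hu : u = ∑ i, v.coord (Sum.inl i) u • v (Sum.inl i) +
      ∑ i, v.coord (Sum.inr i) u • v (Sum.inr i) := by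
    conv_lhs => rw [← v.sum_repr u, Fintype.sum_sum_type]
    rfl
  have hp : QuadraticMap.polar q (∑ i, v.coord (Sum.inl i) u • v (Sum.inl i))
      (∑ i, v.coord (Sum.inr i) u • v (Sum.inr i)) =
      ∑ i, v.coord (Sum.inl (σ i)) u * v.coord (Sum.inr i) u := by
    rw [QuadraticMap.polar_comm, ← QuadraticMap.polarBilin_apply_apply]
    simp only [map_sum, LinearMap.sum_apply, map_smul, LinearMap.smul_apply, hfe, smul_eq_mul,
      mul_ite, mul_one, mul_zero, Finset.mul_sum]
    rw [Finset.sum_comm]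
    simp
  conv_lhs => rw [hu]
  rw [QuadraticMap.map_add q, hp, map_sum_smul_of_polarBilin_eq_zero q _ _ hee,
    map_sum_smul_of_polarBilin_eq_zero q _ _ hff]
  simp only [hf, mul_zero, Finset.sum_const_zero, add_zero]
  congr 1
  exact Finset.sum_congr rfl fun i _ => mul_comm _ _

theorem hasNormalForm_of_isKroneckerBasis [CharP k 2] {m : ℕ}
    (e : Module.Basis (Fin (2 * m + 1)) k E) {q₀ q₁ : QuadraticForm k E}
    {v : Module.Basis (Fin (m + 1) ⊕ Fin m) k E}
    (hv : IsKroneckerBasis q₀.polarBilin q₁.polarBilin v)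
    (hff : ∀ i j, q₀.polarBilin (v (Sum.inr i)) (v (Sum.inr j)) = 0 ∧
      q₁.polarBilin (v (Sum.inr i)) (v (Sum.inr j)) = 0)
    (hf : ∀ i, q₀ (v (Sum.inr i)) = 0 ∧ q₁ (v (Sum.inr i)) = 0) :
    HasNormalForm e q₀ q₁ (fun _ => 0) := by
  obtain ⟨δ, hδ, hcoeff⟩ := halfDiscCoeff_of_isKroneckerBasis e hv hff
  let d : kˣ := Units.mk0 δ hδ
  -- Scaling `e_i` by `δ` and `f_j` by `δ⁻¹` preserves the pairing and multiplies the `q(e_i)` by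
  -- `δ²`, as the coefficients of `Δ` demand.
  let u := v.unitsSMul (Sum.elim (fun _ => d) fun _ => d⁻¹)
  have hul : ∀ i, u (Sum.inl i) = δ • v (Sum.inl i) := fun i => by
    simp [u, Module.Basis.unitsSMul_apply, d, Units.smul_def]
  have hur : ∀ i, u (Sum.inr i) = δ⁻¹ • v (Sum.inr i) := fun i => by
    simp [u, Module.Basis.unitsSMul_apply, d, Units.smul_def]
  have hcoord : ∀ a w, u.dualBasis a w = u.coord a w := fun a w => by
    rw [Module.Basis.dualBasis_apply, Module.Basis.coord_apply]
  refine ⟨u.dualBasis, fun w => ?_, fun w => ?_⟩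
  · rw [map_eq_of_adapted_basis (q := q₀) (σ := Fin.succ) u]
    · simp only [hcoord, (hcoeff _).1, hul, QuadraticMap.map_smul, smul_eq_mul, zero_mul,
        Finset.sum_const_zero, add_zero, sq]
    · intro i j; simp only [hul, map_smul, LinearMap.smul_apply, (hv.1 i j).1, smul_zero]
    · intro i j; simp only [hur, map_smul, LinearMap.smul_apply, (hff i j).1, smul_zero]
    · intro i j
      simp only [hul, hur, map_smul, LinearMap.smul_apply, hv.2.1, smul_eq_mul]
      rw [mul_inv_cancel_left₀ hδ]
    · intro i; rw [hur, QuadraticMap.map_smul, (hf i).1, smul_zero]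
  · rw [map_eq_of_adapted_basis (q := q₁) (σ := Fin.castSucc) u]
    · simp only [hcoord, (hcoeff _).2, hul, QuadraticMap.map_smul, smul_eq_mul, zero_mul,
        Finset.sum_const_zero, add_zero, sq]
    · intro i j; simp only [hul, map_smul, LinearMap.smul_apply, (hv.1 i j).2, smul_zero]
    · intro i j; simp only [hur, map_smul, LinearMap.smul_apply, (hff i j).2, smul_zero]
    · intro i j
      simp only [hul, hur, map_smul, LinearMap.smul_apply, hv.2.2, smul_eq_mul]
      rw [mul_inv_cancel_left₀ hδ]
    · intro i; rw [hur, QuadraticMap.map_smul, (hf i).2, smul_zero]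

variable [FiniteDimensional k E]

theorem exists_subspace_of_hasNormalForm {m : ℕ} {e : Module.Basis (Fin (2 * m + 1)) k E}
    {p₀ p₁ : QuadraticForm k E} (h : HasNormalForm e p₀ p₁ (fun _ => 0)) :
    ∃ L : Submodule k E, Module.finrank k L = m ∧ ∀ v ∈ L, p₀ v = 0 ∧ p₁ v = 0 := by
  obtain ⟨B, h₀, h₁⟩ := h
  let v : Module.Basis (Fin (m + 1) ⊕ Fin m) k E := B.dualBasis.map (Module.evalEquiv k E).symm
  have hBv : ∀ a b, B a (v b) = if b = a then 1 else 0 := by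
    intro a b
    have h1 : Module.evalEquiv k E (v b) = B.dualBasis b := by simp [v]
    have h2 : Module.evalEquiv k E (v b) (B a) = B a (v b) := by simp
    rw [← h2, h1, Module.Basis.dualBasis_apply_self]
    simp only [eq_comm]
  have hli : LinearIndependent k fun i : Fin m => v (Sum.inr i) :=
    v.linearIndependent.comp Sum.inr Sum.inr_injective
  refine ⟨Submodule.span k (Set.range fun i : Fin m => v (Sum.inr i)), ?_, fun u hu => ?_⟩
  · rw [finrank_span_eq_card hli, Fintype.card_fin]
  · have hB : ∀ i, B (Sum.inl i) u = 0 := fun i =>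
      (Submodule.span_le.2 (by rintro _ ⟨j, rfl⟩; simp [hBv]) :
        _ ≤ LinearMap.ker (B (Sum.inl i))) hu
    simp [h₀, h₁, hB]

theorem finrank_baseChange_algebraicClosure (L : Submodule k E) :
    Module.finrank (AlgebraicClosure k) (L.baseChange (AlgebraicClosure k)) = Module.finrank k L := by
  have h : Function.Injective (L.subtype.baseChange (AlgebraicClosure k)) :=
    Module.Flat.lTensor_preserves_injective_linearMap (M := AlgebraicClosure k) L.subtype
      L.injective_subtype
  rw [Submodule.baseChange, LinearMap.finrank_range_of_inj h, Module.finrank_baseChange]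

theorem liesOn_baseChange {q₀ q₁ : QuadraticForm k E} {L : Submodule k E}
    (hL : ∀ v ∈ L, q₀ v = 0 ∧ q₁ v = 0) : LiesOn q₀ q₁ (L.baseChange (AlgebraicClosure k)) := by
  have key : ∀ q : QuadraticForm k E, (∀ v ∈ L, q v = 0) →
      ∀ v ∈ L.baseChange (AlgebraicClosure k), extendScalars (AlgebraicClosure k) q v = 0 := by
    intro q hq v hv
    rw [Submodule.baseChange_eq_span] at hv
    refine map_eq_zero_of_mem_span ?_ ?_ hv
    · rintro _ ⟨w, hw, rfl⟩
      rw [TensorProduct.mk_apply, extendScalars_tmul, hq w hw, map_zero, mul_zero]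
    · rintro _ ⟨w, hw, rfl⟩ _ ⟨x, hx, rfl⟩
      have : QuadraticMap.polar q w x = 0 := by
        rw [QuadraticMap.polar, hq _ (add_mem hw hx), hq w hw, hq x hx, sub_zero, sub_zero]
      rw [QuadraticMap.polarBilin_apply_apply, TensorProduct.mk_apply, TensorProduct.mk_apply,
        polar_extendScalars_tmul, this, map_zero, mul_zero]
  exact fun v hv => ⟨key q₀ (fun w hw => (hL w hw).1) v hv, key q₁ (fun w hw => (hL w hw).2) v hv⟩

/-- By regularity `b₁` embeds `N` into its own annihilator, so `2 dim N ≤ 2m + 1`. -/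
theorem finrank_le_of_liesOn {m : ℕ} (hE : Module.finrank k E = 2 * m + 1)
    {q₀ q₁ : QuadraticForm k E} (hreg : IsRegularPair q₀ q₁)
    {N : Submodule (AlgebraicClosure k) (AlgebraicClosure k ⊗[k] E)} (hN : LiesOn q₀ q₁ N) :
    Module.finrank (AlgebraicClosure k) N ≤ m := by
  let b := (extendScalars (AlgebraicClosure k) q₁).polarBilin
  have h1 : Module.finrank (AlgebraicClosure k) (N.map b) =
      Module.finrank (AlgebraicClosure k) N := by
    refine finrank_map_of_injOn fun v hv h => ?_
    refine polarBilin_eq_zero_of_isRegularPair hreg (hN v hv).1 (hN v hv).2 (s := 0) (t := 1)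
      (Or.inr one_ne_zero) fun u => ?_
    rw [zero_mul, zero_add, one_mul]
    exact LinearMap.congr_fun h u
  have h2 : N.map b ≤ N.dualAnnihilator := by
    rintro _ ⟨v, hv, rfl⟩
    rw [Submodule.mem_dualAnnihilator]
    intro w hw
    simp only [b]
    rw [QuadraticMap.polarBilin_apply_apply, QuadraticMap.polar, (hN _ (add_mem hv hw)).2,
      (hN v hv).2, (hN w hw).2, sub_zero, sub_zero]
  have h3 : Module.finrank (AlgebraicClosure k) (N.map b) ≤
    Module.finrank (AlgebraicClosure k) N.dualAnnihilator := Submodule.finrank_mono h2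
  have h4 := Subspace.finrank_add_finrank_dualAnnihilator_eq N
  rw [Module.finrank_baseChange, hE] at h4
  omega

theorem isQuasiSplit_of_subspace {m : ℕ} (hE : Module.finrank k E = 2 * m + 1)
    {q₀ q₁ : QuadraticForm k E} (hreg : IsRegularPair q₀ q₁) {L : Submodule k E}
    (hLm : Module.finrank k L = m) (hL : ∀ v ∈ L, q₀ v = 0 ∧ q₁ v = 0) : IsQuasiSplit q₀ q₁ :=
  ⟨L, liesOn_baseChange hL, fun _ hN => (finrank_le_of_liesOn hE hreg hN).trans
    (by rw [finrank_baseChange_algebraicClosure, hLm])⟩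

/-- A generator is only assumed maximal; comparison with the subspace of dimension `m` that exists
over the closure shows that its dimension is `m`. -/
theorem hasNormalForm_of_isQuasiSplit [CharP k 2] {m : ℕ}
    (e : Module.Basis (Fin (2 * m + 1)) k E) {q₀ q₁ : QuadraticForm k E}
    (hreg : IsRegularPair q₀ q₁) (h : IsQuasiSplit q₀ q₁) :
    HasNormalForm e q₀ q₁ (fun _ => 0) := by
  have hE : Module.finrank k E = 2 * m + 1 := by
    rw [Module.finrank_eq_card_basis e, Fintype.card_fin]
  obtain ⟨L, hL, hmax⟩ := h
  have hchar : CharP (AlgebraicClosure k) 2 :=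
    charP_of_injective_algebraMap (algebraMap k (AlgebraicClosure k)).injective 2
  obtain ⟨N, hNm, hN⟩ := exists_singular_subspace (m := m)
    (q₀ := extendScalars (AlgebraicClosure k) q₀) (q₁ := extendScalars (AlgebraicClosure k) q₁)
    (by rw [Module.finrank_baseChange, hE])
    (fun v hv h₀ h₁ s t hst => LinearIndependent.pair_iff.1 (hreg v hv h₀ h₁) s t
      (LinearMap.ext fun u => by simpa using hst u))
  have hLm : Module.finrank k L = m := by
    apply le_antisymm
    · rw [← finrank_baseChange_algebraicClosure]
      exact finrank_le_of_liesOn hE hreg hL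
    · rw [← finrank_baseChange_algebraicClosure, ← hNm]
      exact hmax N hN
  obtain ⟨v, hv, hvL⟩ := exists_isKroneckerBasis_of_liesOn hE hreg hL hLm
  have hq : ∀ w ∈ L, q₀ w = 0 ∧ q₁ w = 0 := fun w hw => extendScalars_eq_zero_of_liesOn hL hw
  refine hasNormalForm_of_isKroneckerBasis e hv (fun i j => ?_) fun i => hq _ (hvL i)
  simp only [QuadraticMap.polarBilin_apply_apply, QuadraticMap.polar, hq _ (hvL i), hq _ (hvL j),
    hq _ (add_mem (hvL i) (hvL j)), sub_zero, and_self]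

theorem isQuasiSplit_of_isAlgClosed [IsAlgClosed k] [CharP k 2] {m : ℕ}
    (hE : Module.finrank k E = 2 * m + 1) {q₀ q₁ : QuadraticForm k E}
    (hreg : IsRegularPair q₀ q₁) : IsQuasiSplit q₀ q₁ := by
  obtain ⟨L, hLm, hL⟩ := exists_singular_subspace hE (q₀ := q₀) (q₁ := q₁) (by
    intro v hv h₀ h₁ s t hst
    by_contra hne
    let φ := algebraMap k (AlgebraicClosure k)
    refine one_tmul_ne_zero (AlgebraicClosure k) hv (polarBilin_eq_zero_of_isRegularPair hreg
      (by rw [extendScalars_tmul, h₀, map_zero, mul_zero])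
      (by rw [extendScalars_tmul, h₁, map_zero, mul_zero]) (s := φ s) (t := φ t) ?_ fun u => ?_)
    · simp only [φ, ne_eq, FaithfulSMul.algebraMap_eq_zero_iff]
      tauto
    · induction u with
      | zero => simp
      | add x y hx hy =>
        rw [map_add, map_add]
        linear_combination hx + hy
      | tmul c u =>
        have h := congrArg φ (hst u)
        rw [map_add, map_mul, map_mul, map_zero] at h
        rw [QuadraticMap.polarBilin_apply_apply, QuadraticMap.polarBilin_apply_apply] at h ⊢
        rw [polar_extendScalars_tmul, polar_extendScalars_tmul]
        linear_combination c * h)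
  exact isQuasiSplit_of_subspace hE hreg hLm hL

end NormalForm

end QuadricPencil

/-! ### The equivalences -/

theorem theorem1p3 {k : Type*} {E : Type*} [Field k] [CharP k 2] [AddCommGroup E] [Module k E]
    [FiniteDimensional k E] (m : ℕ) (hm : 1 ≤ m)
    (e : Module.Basis (Fin (2 * m + 1)) k E) (q₀ q₁ : QuadraticForm k E)
    (hreg : QuadricPencil.IsRegularPair q₀ q₁) :
    (IsAlgClosed k → QuadricPencil.HasNormalForm e q₀ q₁ (fun _ => 0)) ∧
    (QuadricPencil.IsQuasiSplit q₀ q₁ ↔ QuadricPencil.HasNormalForm e q₀ q₁ (fun _ => 0)) ∧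
    (QuadricPencil.IsQuasiSplit q₀ q₁ ↔
      ∃ p₀ p₁ : QuadraticForm k E, Submodule.span k {p₀, p₁} = Submodule.span k {q₀, q₁} ∧
        QuadricPencil.HasNormalForm e p₀ p₁ (fun _ => 0)) := by
  have hE : Module.finrank k E = 2 * m + 1 := by
    rw [Module.finrank_eq_card_basis e, Fintype.card_fin]
  have hpencil : ∀ p₀ p₁ : QuadraticForm k E,
      Submodule.span k {p₀, p₁} = Submodule.span k {q₀, q₁} →
      QuadricPencil.HasNormalForm e p₀ p₁ (fun _ => 0) → QuadricPencil.IsQuasiSplit q₀ q₁ := by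
    intro p₀ p₁ hspan h
    obtain ⟨L, hLm, hL⟩ := QuadricPencil.exists_subspace_of_hasNormalForm h
    -- All members of the pencil vanish on `L`, so the choice of spanning pair is irrelevant.
    have key : ∀ q ∈ Submodule.span k {p₀, p₁}, ∀ v ∈ L, q v = 0 := by
      intro q hq v hv
      obtain ⟨a, b, rfl⟩ := Submodule.mem_span_pair.1 hq
      simp [hL v hv]
    rw [hspan] at key
    exact QuadricPencil.isQuasiSplit_of_subspace hE hreg hLm fun v hv =>
      ⟨key q₀ (Submodule.subset_span (by simp)) v hv, key q₁ (Submodule.subset_span (by simp)) v hv⟩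
  refine ⟨fun _ => ?_, ⟨?_, hpencil q₀ q₁ rfl⟩, ⟨fun h => ⟨q₀, q₁, rfl, ?_⟩, ?_⟩⟩
  · exact QuadricPencil.hasNormalForm_of_isQuasiSplit e hreg
      (QuadricPencil.isQuasiSplit_of_isAlgClosed hE hreg)
  · exact QuadricPencil.hasNormalForm_of_isQuasiSplit e hreg
  · exact QuadricPencil.hasNormalForm_of_isQuasiSplit e hreg h
  · rintro ⟨p₀, p₁, hspan, h⟩
    exact hpencil p₀ p₁ hspan h
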